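/- **Setting.** An integer register of $n$ qubits holds $x=\sum_{i<n}2^i x_i$ in the computational basis. A circuit on a given set of qubits is a finite list of gates acting on these qubits only (so it uses no ancilla qubit, clean or dirty); the gates are $X$, Hadamard, CNOT, Toffoli, and the phase rotations $R_\theta$, $CR_\theta$, $CCR_\theta$ with arbitrary real angle $\theta$ and zero, one or two controls. The gate count is the length of the list, and "implements" means exact equality of operators. Let $$\mathsf{PhaseTripleProduct}(\varphi)\,|x\rangle|y\rangle|z\rangle=e^{i\varphi xyz}|x\rangle|y\rangle|z\rangle,\qquad \mathsf{PhaseProduct}(\varphi)\,|x\rangle|z\rangle=e^{i\varphi xz}|x\rangle|z\rangle .$$ Let $k\ge 2$ be an integer and $q=3k-2$. For $\mathbf x\in\mathbb R^k$ put $x(b)=\sum_{i<k}x_ib^i$, and for an evaluation point $(u,v)$ put $x(u,v)=\sum_{i<k}x_iu^iv^{k-1-i}$ (the point $w$ is $(w,1)$; the point $1/c$, including $\infty$ for $c=0$, is $(1,c)$). **Theorem.** 1. (Degree and number of points.) For $\mathbf x,\mathbf y,\mathbf z\in\mathbb R^k$ the product polynomial $p=x(b)y(b)z(b)$ has degree at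 most $3(k-1)$, with equality if the top digits $x_{k-1},y_{k-1},z_{k-1}$ are nonzero. The values of $p$ at any $q$ distinct real points determine $p$ among such products; the values at any fewer than $q$ points do not. 2. (Decomposition of the phase.) Let $(u_\ell,v_\ell)\in\mathbb R^2$, $0\le\ell<q$, satisfy $u_iv_j\ne u_jv_i$ for $i\neq j$. Then the matrix $A=(u_\ell^{\,j}v_\ell^{\,q-1-j})_{0\le\ell,j<q}$ is invertible and, with $\vec\varphi=\varphi\,(1,B,\dots,B^{q-1})A^{-1}$, for all $\varphi,B\in\mathbb R$ and $\mathbf x,\mathbf y,\mathbf z\in\mathbb R^k$, $$\varphi\,x(B)\,y(B)\,z(B)=\sum_{\ell=0}^{q-1}\varphi_\ell\;x(u_\ell,v_\ell)\,y(u_\ell,v_\ell)\,z(u_\ell,v_\ell).$$ 3. (One term of the decomposition, overflow included.) Let $(u,v)\in\mathbb Z^2$ with $|u|=1$ or $|v|=1$, and let $\kappa\ge2$. There is a constant $C$, depending only on $k,u,v,\kappa$, such that for all $n$, all $l,m\le n$, $p\le 2n$, all $\varphi\in\mathbb R$ and every circuit $D$ implementing $\mathsf{PhaseTripleProduct}(\varphi)$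 on registers of $l,m,p$ qubits, the phase $$|\mathbf x\rangle|\mathbf y\rangle|\mathbf z\rangle\mapsto e^{i\varphi\,x(u,v)\,y(u,v)\,z(u,v)}|\mathbf x\rangle|\mathbf y\rangle|\mathbf z\rangle ,$$ where $\mathbf x,\mathbf y,\mathbf z$ consist of $k$ digits of $l$, $m$, $p$ qubits respectively, is implemented by a circuit on exactly these $k(l+m+p)$ qubits with at most $|D|+C\,n^{\log_\kappa(2\kappa-1)}$ gates, where $|D|$ is the gate count of $D$. 4. (Controlled PhaseProduct.) There is a constant $C$ depending only on $k$ such that for all $n$, $r\le n$, $t\le 2n$ and $\varphi\in\mathbb R$, the operator $\mathsf{PhaseProduct}(\varphi)$ on registers of $r$ and $t$ qubits, controlled by one further qubit, is implemented by a circuit on exactly these $1+r+t$ qubits with at most $C\,n^{\log_k(2k-1)}$ gates. 5. (PhaseTripleProduct and multiplication.) There is a constant $C$ depending only on $k$ such that for all $n$, all $r,s\le n$ and $t\le 2n$, each of the following is implemented by a circuit on exactly the $r+s+t$ qubits of the three registers, with at most $C\,n^{\log_k(3k-2)}$ gates: - $\mathsf{PhaseTripleProduct}(\varphi)$, for every $\varphi\in\mathbb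 R$; - the quantum-quantum multiplication $|x\rangle|y\rangle|w\rangle\mapsto|x\rangle|y\rangle|w+xy \bmod 2^t\rangle$; - the classical-quantum-quantum multiplication by any $a\in\mathbb R$: the circuit preserves $x$ and $y$; it maps $|x\rangle|y\rangle|w\rangle$ to $|x\rangle|y\rangle|w+axy\bmod 2^t\rangle$ whenever $w+axy$ is an integer; and for all $x,y,w$ and every real $e>1$, measuring the output register gives a value at distance more than $e$ from $w+axy$ modulo $2^t$ with probability at most $\frac1{2(e-1)}$. 6. (Subquadratic.) If $k\ge3$ then $\log_k(3k-2)<2$. -/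

import Mathlib

namespace QMul

/-- Elementary gates on qubits labelled by `ι`: Pauli `X`, Hadamard, CNOT, Toffoli, and phase
rotations by an arbitrary real angle with zero, one or two controls. -/
inductive Gate (ι : Type) : Type
  | X (i : ι)
  | H (i : ι)
  | CNOT (c i : ι) (h : c ≠ i)
  | Toffoli (c d i : ι) (hcd : c ≠ d) (hci : c ≠ i) (hdi : d ≠ i)
  | R (θ : ℝ) (i : ι)
  | CR (θ : ℝ) (i j : ι) (h : i ≠ j)
  | CCR (θ : ℝ) (i j l : ι) (hij : i ≠ j) (hil : i ≠ l) (hjl : j ≠ l)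

/-- Operators on the qubits labelled by `ι`, in the computational basis `ι → Bool`;
column `b` is the image of the basis state `|b⟩`. -/
abbrev Op (ι : Type) : Type := Matrix (ι → Bool) (ι → Bool) ℂ

/-- The operator `|b⟩ ↦ |f b⟩`. -/
def basisMap {ι : Type} [Fintype ι] [DecidableEq ι] (f : (ι → Bool) → (ι → Bool)) : Op ι :=
  Matrix.of fun b' b => if b' = f b then 1 else 0

/-- The diagonal operator `|b⟩ ↦ exp (i θ(b)) |b⟩`. -/
noncomputable def phaseOp {ι : Type} [Fintype ι] [DecidableEq ι] (θ : (ι → Bool) → ℝ) : Op ι :=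
  Matrix.diagonal fun b => Complex.exp (Complex.I * (θ b : ℂ))

/-- The operator of a gate, acting as the identity on the qubits it does not touch. -/
noncomputable def Gate.op {ι : Type} [Fintype ι] [DecidableEq ι] : Gate ι → Op ι
  | .X i => basisMap fun b => Function.update b i (!b i)
  | .H i => Matrix.of fun b' b =>
      if b' = Function.update b i (b' i) then
        (if (b i && b' i) = true then -1 else 1) / (Real.sqrt 2 : ℂ)
      else 0
  | .CNOT c i _ => basisMap fun b => Function.update b i (xor (b i) (b c))
  | .Toffoli c d i _ _ _ => basisMap fun b => Function.update b i (xor (b i) (b c && b d))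
  | .R θ i => phaseOp fun b => if b i = true then θ else 0
  | .CR θ i j _ => phaseOp fun b => if (b i && b j) = true then θ else 0
  | .CCR θ i j l _ _ _ => phaseOp fun b => if (b i && b j && b l) = true then θ else 0

/-- A circuit on exactly the qubits `ι`: a list of gates, the head being applied first.
Its length is the gate count. -/
abbrev Circuit (ι : Type) : Type := List (Gate ι)

/-- The operator implemented by a circuit. -/
noncomputable def Circuit.op {ι : Type} [Fintype ι] [DecidableEq ι] : Circuit ι → Op ι
  | [] => 1
  | g :: c => Circuit.op c * g.op

/-- The integer `∑ bᵢ 2 ^ i` held by a register of `n` qubits. -/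
def val {n : ℕ} (b : Fin n → Bool) : ℕ := ∑ i, (b i).toNat * 2 ^ (i : ℕ)

/-- Three registers of `r`, `s` and `t` qubits and no other qubit. -/
abbrev Reg3 (r s t : ℕ) : Type := Fin r ⊕ Fin s ⊕ Fin t

/-- Value of the first register. -/
def val1 {r s t : ℕ} (b : Reg3 r s t → Bool) : ℕ := val fun i => b (Sum.inl i)

/-- Value of the second register. -/
def val2 {r s t : ℕ} (b : Reg3 r s t → Bool) : ℕ := val fun i => b (Sum.inr (Sum.inl i))

/-- Value of the third register. -/
def val3 {r s t : ℕ} (b : Reg3 r s t → Bool) : ℕ := val fun i => b (Sum.inr (Sum.inr i))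

/-- `|x⟩|y⟩|z⟩ ↦ exp (i φ x y z) |x⟩|y⟩|z⟩`. -/
noncomputable def phaseTripleProduct (r s t : ℕ) (φ : ℝ) : Op (Reg3 r s t) :=
  phaseOp fun b => φ * val1 b * val2 b * val3 b

/-- `|c⟩|x⟩|z⟩ ↦ exp (i φ x z) |c⟩|x⟩|z⟩` if the control qubit `c` is `1`, and the identity if
it is `0`. -/
noncomputable def controlledPhaseProduct (r t : ℕ) (φ : ℝ) : Op (Unit ⊕ Fin r ⊕ Fin t) :=
  phaseOp fun b =>
    if b (Sum.inl ()) = true then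
      φ * val (fun i => b (Sum.inr (Sum.inl i))) * val (fun i => b (Sum.inr (Sum.inr i)))
    else 0

/-- `|x⟩|y⟩|w⟩ ↦ |x⟩|y⟩|w + x y mod 2 ^ t⟩`. -/
def quantumMultiply (r s t : ℕ) : Op (Reg3 r s t) :=
  Matrix.of fun b' b =>
    if val1 b' = val1 b ∧ val2 b' = val2 b ∧ val3 b' = (val3 b + val1 b * val2 b) % 2 ^ t
    then 1 else 0

/-- Distance from `v` to the nearest multiple of `M` (for `M > 0`). -/
noncomputable def circDist (M v : ℝ) : ℝ := |v - M * round (v / M)|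

/-- `U` performs the classical-quantum-quantum multiplication
`|x⟩|y⟩|w⟩ ↦ |x⟩|y⟩|w + a x y mod 2 ^ t⟩` by the real number `a`: it leaves `x` and `y` alone;
where `w + a x y` is an integer the result is exact; in all cases, a measurement of the output
register gives a value farther than `e > 1` from `w + a x y` (modulo `2 ^ t`) with probability at
most `1 / (2 (e - 1))`. -/
def IsScaledMultiply {r s t : ℕ} (a : ℝ) (U : Op (Reg3 r s t)) : Prop :=
  ∀ b : Reg3 r s t → Bool,
    (∀ b', U b' b ≠ 0 → val1 b' = val1 b ∧ val2 b' = val2 b) ∧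
    (∀ v : ℤ, (v : ℝ) = val3 b + a * val1 b * val2 b →
      ∀ b', U b' b =
        if val1 b' = val1 b ∧ val2 b' = val2 b ∧ (val3 b' : ℤ) = v % 2 ^ t then 1 else 0) ∧
    (∀ e : ℝ, 1 < e →
      ∑ b' with e < circDist (2 ^ t) ((val3 b' : ℝ) - (val3 b + a * val1 b * val2 b)),
        ‖U b' b‖ ^ 2 ≤ 1 / (2 * (e - 1)))

/-- The polynomial whose coefficients are the `k` digits `x`. -/
noncomputable def digitPoly {k : ℕ} (x : Fin k → ℝ) : Polynomial ℝ :=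
  ∑ i, Polynomial.C (x i) * Polynomial.X ^ (i : ℕ)

/-- The homogeneous form `∑ xᵢ uⁱ v ^ (k - 1 - i)` of the digit polynomial. The evaluation point
`w` is `(u, v) = (w, 1)`, the point `1 / c` is `(1, c)` (so that the value gets multiplied by
`c ^ (k - 1)`), and the point `∞` is `(1, 0)`. -/
def evalPoint {k : ℕ} (x : Fin k → ℝ) (u v : ℝ) : ℝ :=
  ∑ i, x i * (u ^ (i : ℕ) * v ^ (k - 1 - (i : ℕ)))

/-- Three registers, each consisting of `k` digits, of `l`, `m` and `p` qubits respectively. -/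
abbrev DigitReg3 (k l m p : ℕ) : Type := (Fin k × Fin l) ⊕ (Fin k × Fin m) ⊕ (Fin k × Fin p)

/-- `|𝐱⟩|𝐲⟩|𝐳⟩ ↦ exp (i φ x(u,v) y(u,v) z(u,v)) |𝐱⟩|𝐲⟩|𝐳⟩`: the phase of the pointwise product of
the three factors at one evaluation point. -/
noncomputable def pointwisePhase (k l m p : ℕ) (u v φ : ℝ) : Op (DigitReg3 k l m p) :=
  phaseOp fun b =>
    φ * evalPoint (fun i : Fin k => (val fun j : Fin l => b (Sum.inl (i, j)) : ℝ)) u v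
      * evalPoint (fun i : Fin k => (val fun j : Fin m => b (Sum.inr (Sum.inl (i, j))) : ℝ)) u v
      * evalPoint (fun i : Fin k => (val fun j : Fin p => b (Sum.inr (Sum.inr (i, j))) : ℝ)) u v

end QMul

open QMul

namespace QMul

set_option linter.unusedSectionVars false

/-! ### Circuits, their operators and their inverses -/

variable {ι : Type} [Fintype ι] [DecidableEq ι]

/-! The algebra is three-factor Toom-Cook. Cut each register into `k` digits. The product of the
three digit polynomials has degree at most `3k - 3`, so its value at `2 ^ l` is a fixed linear
combination of its values at `3k - 2` points. The weights are real numbers and go into the angles. A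
large triple product in the phase thus becomes a sum of `3k - 2` phases, each the product of three
linear forms in the digits.

The difficulty is to realise such a product without ancillas. Conjugating a diagonal phase by a
reversible circuit composes the phase function with the permutation (`Ph.conj`), so adding one digit
into another in place turns the phase of a digit into that of a linear form. The sum does not fit
into the register, but its exact value is the stored value plus `2 ^ l` times the carry. The missing
multiple of the carry is put back as a separate phase (`Ph.add_multiple`). Since the carry
multiplies only the other two factors, this correction is a controlled product of two registers.

The carry is never stored. It can be added to any qubit outside the two registers, by running a
carry chain forwards and backwards (`Mp.xor_carry`), and it can be put into the phase as a
combination of register values before and after an addition (`Ctl.carry`). A control is supplied by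
conditionally complementing a register, which needs only uncontrolled phases and smaller controlled
ones (`Ctl.mul_reg`).

Corrections in the triple product cost a bounded number of two-factor phases. The same method with
`2k - 1` points gives those in `O((2k - 1) ^ d)` gates on `k ^ d` qubits. As `2k - 1 < 3k - 2`, they
do not affect the order of the triple recursion, which is `O((3k - 2) ^ d)` (`bound_of_recursion`).

Multiplication is addition in the Fourier basis: a phase proportional to `x y j`, with `j` the
Fourier variable, between a transform of the output register and its inverse. The transform is built
recursively from two-factor phases (`qft_append`). If the shift is not an integer, the amplitudes
are normalised geometric sums, and their decay gives the measurement bound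
(`sum_norm_fourierMean_le`). -/

theorem Circuit.op_append (c d : Circuit ι) :
    Circuit.op (c ++ d) = Circuit.op d * Circuit.op c := by
  induction c with
  | nil => simp [Circuit.op]
  | cons g c ih => simp [Circuit.op, ih, Matrix.mul_assoc]

/-- The inverse gate. -/
def Gate.inv {ι : Type} : Gate ι → Gate ι
  | .X i => .X i
  | .H i => .H i
  | .CNOT c i h => .CNOT c i h
  | .Toffoli c d i h1 h2 h3 => .Toffoli c d i h1 h2 h3
  | .R θ i => .R (-θ) i
  | .CR θ i j h => .CR (-θ) i j h
  | .CCR θ i j l h1 h2 h3 => .CCR (-θ) i j l h1 h2 h3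

theorem phaseOp_conjTranspose (θ : (ι → Bool) → ℝ) :
    (phaseOp θ).conjTranspose = phaseOp fun b => -θ b := by
  rw [phaseOp, phaseOp, Matrix.diagonal_conjTranspose]
  congr 1
  ext b
  simp [← Complex.exp_conj]

theorem phaseOp_mul (θ η : (ι → Bool) → ℝ) :
    phaseOp θ * phaseOp η = phaseOp fun b => θ b + η b := by
  rw [phaseOp, phaseOp, phaseOp, Matrix.diagonal_mul_diagonal]
  congr 1
  ext b
  rw [← Complex.exp_add]
  push_cast
  ring_nf

theorem phaseOp_zero : phaseOp (fun _ : ι → Bool => 0) = 1 := by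
  simp [phaseOp]

theorem basisMap_conjTranspose (f : Equiv.Perm (ι → Bool)) :
    (basisMap f).conjTranspose = basisMap f.symm := by
  ext b' b
  simp only [basisMap, Matrix.conjTranspose_apply, Matrix.of_apply]
  by_cases h : b = f b'
  · simp [h]
  · rw [if_neg h, if_neg]
    · simp
    · rintro rfl
      simp at h

theorem basisMap_mul (f g : (ι → Bool) → (ι → Bool)) :
    basisMap f * basisMap g = basisMap (f ∘ g) := by
  ext b' b
  simp [basisMap, Matrix.mul_apply]

theorem basisMap_id : basisMap (id : (ι → Bool) → (ι → Bool)) = 1 := by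
  ext b' b
  simp [basisMap, Matrix.one_apply]

/-- The substitution principle of the proof: computing in place, applying a phase and uncomputing
evaluates the phase function at the computed state. -/
theorem basisMap_conj_phaseOp (f : Equiv.Perm (ι → Bool)) (θ : (ι → Bool) → ℝ) :
    basisMap f.symm * (phaseOp θ * basisMap f) = phaseOp (θ ∘ f) := by
  ext b' b
  simp only [basisMap, phaseOp, Matrix.mul_apply, Matrix.of_apply, Matrix.diagonal_apply]
  simp only [ite_mul, zero_mul, mul_ite, mul_one, mul_zero, one_mul, Finset.sum_ite_eq',
    Finset.mem_univ, if_true, Equiv.symm_apply_apply, Function.comp_apply]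
  split_ifs with h
  · rw [h]
  · rfl

/-- Flip of one bit by a Boolean function that does not read this bit. -/
def xorPerm (c : (ι → Bool) → Bool) (g : ι) (h : ∀ b v, c (Function.update b g v) = c b) :
    Equiv.Perm (ι → Bool) :=
  Function.Involutive.toPerm (fun b => Function.update b g (xor (b g) (c b))) (by
    intro b
    simp [h])

theorem xorPerm_apply (c : (ι → Bool) → Bool) (g : ι) (h) (b : ι → Bool) :
    xorPerm c g h b = Function.update b g (xor (b g) (c b)) := rfl

theorem xorPerm_symm (c : (ι → Bool) → Bool) (g : ι) (h) :
    (xorPerm c g h).symm = xorPerm c g h := rfl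

theorem op_X (i : ι) :
    (Gate.X i).op = basisMap (xorPerm (fun _ => true) i (fun _ _ => rfl)) := by
  simp [Gate.op, xorPerm_apply, basisMap]

theorem op_CNOT (c i : ι) (h : c ≠ i) :
    (Gate.CNOT c i h).op = basisMap (xorPerm (fun b => b c) i (by simp [h])) := rfl

theorem op_Toffoli (c d i : ι) (hcd : c ≠ d) (h : c ≠ i) (h' : d ≠ i) :
    (Gate.Toffoli c d i hcd h h').op =
      basisMap (xorPerm (fun b => b c && b d) i (by simp [h, h'])) := rfl

theorem Gate.op_inv (g : Gate ι) : g.inv.op = g.op.conjTranspose := by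
  cases g with
  | X i => rw [Gate.inv, op_X, basisMap_conjTranspose, xorPerm_symm]
  | CNOT c i h => rw [Gate.inv, op_CNOT, basisMap_conjTranspose, xorPerm_symm]
  | Toffoli c d i h1 h2 h3 => rw [Gate.inv, op_Toffoli, basisMap_conjTranspose, xorPerm_symm]
  | H i =>
    ext b' b
    simp only [Gate.inv, Gate.op, Matrix.conjTranspose_apply, Matrix.of_apply]
    have : (b' = Function.update b i (b' i)) ↔ (b = Function.update b' i (b i)) := by
      constructor
      · intro h; rw [h]; simp
      · intro h; rw [h]; simp
    by_cases h : b' = Function.update b i (b' i)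
    · rw [if_pos h, if_pos (this.1 h), Bool.and_comm]
      split_ifs <;> simp [Complex.conj_ofReal]
    · rw [if_neg h, if_neg (fun h' => h (this.2 h'))]; simp
  | R θ i =>
    simp only [Gate.inv, Gate.op, phaseOp_conjTranspose]
    congr 1; ext b; split_ifs <;> simp
  | CR θ i j h =>
    simp only [Gate.inv, Gate.op, phaseOp_conjTranspose]
    congr 1; ext b; split_ifs <;> simp
  | CCR θ i j l h1 h2 h3 =>
    simp only [Gate.inv, Gate.op, phaseOp_conjTranspose]
    congr 1; ext b; split_ifs <;> simp

theorem Circuit.op_reverse_inv (c : Circuit ι) :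
    Circuit.op ((c.map Gate.inv).reverse) = c.op.conjTranspose := by
  induction c with
  | nil => simp [Circuit.op]
  | cons g c ih =>
    simp only [List.map_cons, List.reverse_cons, Circuit.op_append, ih, Circuit.op,
      Gate.op_inv, Matrix.conjTranspose_mul, one_mul]

/-! ### Gate counts of phases and of basis permutations -/

/-- `M` is implemented by a circuit of at most `N` gates. -/
def Impl (M : Op ι) (N : ℕ) : Prop := ∃ c : Circuit ι, c.op = M ∧ c.length ≤ N

theorem Impl.one : Impl (1 : Op ι) 0 := ⟨[], rfl, le_rfl⟩

theorem Impl.mono {M : Op ι} {N N' : ℕ} (h : Impl M N) (hN : N ≤ N') : Impl M N' := by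
  obtain ⟨c, hc, hl⟩ := h
  exact ⟨c, hc, hl.trans hN⟩

theorem Impl.mul {M M' : Op ι} {N N' : ℕ} (h : Impl M N) (h' : Impl M' N') :
    Impl (M * M') (N + N') := by
  obtain ⟨c, hc, hl⟩ := h
  obtain ⟨c', hc', hl'⟩ := h'
  refine ⟨c' ++ c, by rw [Circuit.op_append, hc, hc'], ?_⟩
  rw [List.length_append]; omega

theorem Impl.conjTranspose {M : Op ι} {N : ℕ} (h : Impl M N) : Impl M.conjTranspose N := by
  obtain ⟨c, hc, hl⟩ := h
  exact ⟨(c.map Gate.inv).reverse, by rw [Circuit.op_reverse_inv, hc], by simpa using hl⟩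

theorem Impl.gate (g : Gate ι) : Impl g.op 1 := ⟨[g], by simp [Circuit.op], le_rfl⟩

/-- The diagonal phase `θ` is implemented by at most `N` gates. -/
def Ph (θ : (ι → Bool) → ℝ) (N : ℕ) : Prop := Impl (phaseOp θ) N

/-- The permutation `f` of the computational basis is implemented by at most `N` gates. -/
def Mp (f : Equiv.Perm (ι → Bool)) (N : ℕ) : Prop := Impl (basisMap f) N

theorem Ph.mono {θ : (ι → Bool) → ℝ} {N N' : ℕ} (h : Ph θ N) (hN : N ≤ N') : Ph θ N' :=
  Impl.mono h hN

theorem Ph.zero : Ph (fun _ : ι → Bool => 0) 0 := by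
  rw [Ph, phaseOp_zero]; exact Impl.one

theorem Ph.add {θ η : (ι → Bool) → ℝ} {N N' : ℕ} (h : Ph θ N) (h' : Ph η N') :
    Ph (fun b => θ b + η b) (N + N') := by
  rw [Ph, ← phaseOp_mul]; exact Impl.mul h h'

theorem Ph.sum {J : Type*} (s : Finset J) {θ : J → (ι → Bool) → ℝ} {N : ℕ}
    (h : ∀ j ∈ s, Ph (θ j) N) : Ph (fun b => ∑ j ∈ s, θ j b) (s.card * N) := by
  classical
  induction s using Finset.induction_on with
  | empty => simpa using Ph.zero
  | insert j s hj ih =>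
    have := (h j (Finset.mem_insert_self _ _)).add
      (ih fun i hi => h i (Finset.mem_insert_of_mem hi))
    simp only [Finset.sum_insert hj, Finset.card_insert_of_notMem hj]
    exact this.mono (by rw [add_mul, one_mul, add_comm])

theorem Mp.mono {f : Equiv.Perm (ι → Bool)} {N N' : ℕ} (h : Mp f N) (hN : N ≤ N') : Mp f N' :=
  Impl.mono h hN

theorem Mp.refl : Mp (Equiv.refl (ι → Bool)) 0 := by
  rw [Mp, Equiv.coe_refl, basisMap_id]; exact Impl.one

theorem Mp.trans {f g : Equiv.Perm (ι → Bool)} {N N' : ℕ} (hf : Mp f N) (hg : Mp g N') :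
    Mp (f.trans g) (N + N') := by
  rw [Mp, Equiv.coe_trans, ← basisMap_mul, add_comm]; exact Impl.mul hg hf

theorem Mp.symm {f : Equiv.Perm (ι → Bool)} {N : ℕ} (hf : Mp f N) : Mp f.symm N := by
  rw [Mp, ← basisMap_conjTranspose]; exact Impl.conjTranspose hf

theorem Ph.conj {θ : (ι → Bool) → ℝ} {f : Equiv.Perm (ι → Bool)} {N N' : ℕ} (h : Ph θ N)
    (hf : Mp f N') : Ph (fun b => θ (f b)) (N + 2 * N') := by
  have := Impl.mul hf.symm (Impl.mul h hf)
  rw [basisMap_conj_phaseOp] at this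
  exact Impl.mono this (by omega)

theorem Ph.congr {θ η : (ι → Bool) → ℝ} {N : ℕ} (h : Ph θ N) (he : ∀ b, η b = θ b) : Ph η N := by
  rwa [show η = θ from funext he]

theorem Mp.congr {f g : Equiv.Perm (ι → Bool)} {N : ℕ} (h : Mp f N) (he : f = g) : Mp g N :=
  he ▸ h

theorem Mp.not (i : ι) : Mp (xorPerm (fun _ => true) i (fun _ _ => rfl)) 1 := by
  rw [Mp, ← op_X]; exact Impl.gate _

theorem Mp.cnot {c i : ι} (h : c ≠ i) : Mp (xorPerm (fun b => b c) i (by simp [h])) 1 := by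
  rw [Mp, ← op_CNOT c i h]; exact Impl.gate _

theorem Mp.toffoli {c d i : ι} (hcd : c ≠ d) (h : c ≠ i) (h' : d ≠ i) :
    Mp (xorPerm (fun b => b c && b d) i (by simp [h, h'])) 1 := by
  rw [Mp, ← op_Toffoli c d i hcd h h']; exact Impl.gate _

theorem Ph.bit (α : ℝ) (i : ι) : Ph (fun b => α * ((b i).toNat : ℝ)) 1 :=
  Ph.congr (Impl.gate (Gate.R α i)) fun b => by cases b i <;> simp

theorem Ph.bit2 (α : ℝ) {i j : ι} (h : i ≠ j) :
    Ph (fun b => α * ((b i).toNat : ℝ) * ((b j).toNat : ℝ)) 1 :=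
  Ph.congr (Impl.gate (Gate.CR α i j h)) fun b => by cases b i <;> cases b j <;> simp

theorem Ph.bit3 (α : ℝ) {i j l : ι} (h : i ≠ j) (h' : i ≠ l) (h'' : j ≠ l) :
    Ph (fun b => α * ((b i).toNat : ℝ) * ((b j).toNat : ℝ) * ((b l).toNat : ℝ)) 1 :=
  Ph.congr (Impl.gate (Gate.CCR α i j l h h' h'')) fun b => by
    cases b i <;> cases b j <;> cases b l <;> simp

/-- The value held by the register with qubits `a`. -/
def rval {ι : Type} {r : ℕ} (a : Fin r → ι) (b : ι → Bool) : ℝ := (val fun i => b (a i) : ℕ)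

theorem rval_eq {ι : Type} {r : ℕ} (a : Fin r → ι) (b : ι → Bool) :
    rval a b = ∑ i, ((b (a i)).toNat : ℝ) * 2 ^ (i : ℕ) := by
  simp [rval, val]

theorem rval_congr {ι : Type} {r : ℕ} {a : Fin r → ι} {b b' : ι → Bool}
    (h : ∀ i, b (a i) = b' (a i)) : rval a b = rval a b' := by
  simp [rval_eq, h]

theorem Ph.linear (α : ℝ) {r : ℕ} (a : Fin r → ι) : Ph (fun b => α * rval a b) r := by
  have := Ph.sum Finset.univ (fun (i : Fin r) _ => Ph.bit (α * 2 ^ (i : ℕ)) (a i))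
  simp only [Finset.card_univ, Fintype.card_fin, mul_one] at this
  refine this.congr fun b => ?_
  rw [rval_eq, Finset.mul_sum]
  exact Finset.sum_congr rfl fun i _ => by ring

/-! ### In-place addition and carries without ancillas -/

/-- The carry into position `n` when the binary numbers `x` and `y` are added. -/
def carryBit (x y : ℕ → Bool) : ℕ → Bool
  | 0 => false
  | n + 1 => xor (x n) (xor (x n) (carryBit x y n) && xor (y n) (x n))

theorem carryBit_congr {x y x' y' : ℕ → Bool} {n : ℕ} (hx : ∀ i < n, x i = x' i)
    (hy : ∀ i < n, y i = y' i) : carryBit x y n = carryBit x' y' n := by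
  induction n with
  | zero => rfl
  | succ n ih =>
    simp only [carryBit]
    rw [ih (fun i hi => hx i (by omega)) (fun i hi => hy i (by omega)), hx n (by omega),
      hy n (by omega)]

/-- The formula in `carryBit` is the majority of the two bits and the incoming carry: if the bits
agree, the conjunction vanishes and the carry is their common value; if they differ, it is the
incoming carry. -/
theorem sum_add_carryBit (x y : ℕ → Bool) (n : ℕ) :
    ∑ i ∈ Finset.range n, (xor (xor (x i) (y i)) (carryBit x y i)).toNat * 2 ^ i
      + (carryBit x y n).toNat * 2 ^ n =
    ∑ i ∈ Finset.range n, (x i).toNat * 2 ^ i + ∑ i ∈ Finset.range n, (y i).toNat * 2 ^ i := by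
  induction n with
  | zero => simp [carryBit]
  | succ n ih =>
    rw [Finset.sum_range_succ, Finset.sum_range_succ, Finset.sum_range_succ]
    have key : (xor (xor (x n) (y n)) (carryBit x y n)).toNat
        + 2 * (carryBit x y (n + 1)).toNat =
        (x n).toNat + (y n).toNat + (carryBit x y n).toNat := by
      simp only [carryBit]
      cases x n <;> cases y n <;> cases carryBit x y n <;> rfl
    have key' := congrArg (· * 2 ^ n) key
    simp only [add_mul] at key'
    rw [pow_succ]
    linarith

/-- The qubits `a 0, …, a (n - 1), w 0, …, w (n - 1)` are distinct. -/
structure DistinctPair {ι : Type} (a w : ℕ → ι) (n : ℕ) : Prop where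
  left : ∀ i < n, ∀ j < n, a i = a j → i = j
  right : ∀ i < n, ∀ j < n, w i = w j → i = j
  disj : ∀ i < n, ∀ j < n, a i ≠ w j

theorem DistinctPair.mono {ι : Type} {a w : ℕ → ι} {n m : ℕ} (h : DistinctPair a w n)
    (hm : m ≤ n) : DistinctPair a w m :=
  ⟨fun i hi j hj => h.left i (by omega) j (by omega),
   fun i hi j hj => h.right i (by omega) j (by omega),
   fun i hi j hj => h.disj i (by omega) j (by omega)⟩

/-- After the chain, `a i` and `w i` hold exactly the two factors of the conjunction in the next
carry, so one Toffoli gate per position advances the carry inside the register `a` itself. -/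
theorem exists_carryChain (a w : ℕ → ι) (n : ℕ) (h : DistinctPair a w n) :
    ∃ f : Equiv.Perm (ι → Bool), Mp f (4 * n) ∧
      (∀ b, ∀ i < n, f b (a i) =
        xor (b (a i)) (carryBit (fun j => b (a j)) (fun j => b (w j)) i)) ∧
      (∀ b, ∀ i < n, f b (w i) = xor (b (w i)) (b (a i))) ∧
      (∀ b q, (∀ i < n, q ≠ a i ∧ q ≠ w i) → f b q = b q) := by
  induction n with
  | zero => exact ⟨Equiv.refl _, Mp.refl, by simp, by simp, by simp⟩
  | succ n ih =>
    obtain ⟨f, hf, hfa, hfw, hfo⟩ := ih (h.mono (by omega))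
    rcases n with _ | n
    · have h0 : a 0 ≠ w 0 := h.disj 0 (by omega) 0 (by omega)
      refine ⟨_, (Mp.cnot h0).mono (by omega), ?_, ?_, ?_⟩
      · intro b i hi
        obtain rfl : i = 0 := by omega
        simp [xorPerm_apply, h0, carryBit]
      · intro b i hi
        obtain rfl : i = 0 := by omega
        simp [xorPerm_apply]
      · intro b q hq
        simp [xorPerm_apply, (hq 0 (by omega)).2]
    · have h1 : a (n + 1) ≠ w (n + 1) := h.disj _ (by omega) _ (by omega)
      have h2 : a n ≠ a (n + 1) := fun e => by
        have := h.left _ (by omega) _ (by omega) e; omega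
      have h3 : a n ≠ w n := h.disj _ (by omega) _ (by omega)
      have h4 : w n ≠ a (n + 1) := fun e => h.disj _ (by omega) _ (by omega) e.symm
      have hA : ∀ i < n + 1, a i ≠ a (n + 1) := fun i hi e => by
        have := h.left _ (by omega) _ (by omega) e; omega
      have hW : ∀ i < n + 1, w i ≠ w (n + 1) := fun i hi e => by
        have := h.right _ (by omega) _ (by omega) e; omega
      have hAW : ∀ i < n + 1, a i ≠ w (n + 1) := fun i hi =>
        h.disj _ (by omega) _ (by omega)
      have hWA : ∀ i < n + 1, w i ≠ a (n + 1) := fun i hi e =>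
        h.disj _ (by omega) _ (by omega) e.symm
      -- The CNOT from `a n` to `a (n + 1)` must come before the shorter chain, while `a n` still
      -- holds its input bit: this bit is the other summand of the next carry.
      refine ⟨_, ((((Mp.cnot h1).trans (Mp.cnot h2)).trans hf).trans
        (Mp.toffoli h3 h2 h4)).mono (by omega), ?_, ?_, ?_⟩
      · intro b i hi
        simp only [Equiv.trans_apply, xorPerm_apply]
        set b2 := Function.update (Function.update b (w (n + 1)) (xor (b (w (n + 1)))
          (b (a (n + 1))))) (a (n + 1)) _ with hb2
        have e1 : ∀ j < n + 1, b2 (a j) = b (a j) := fun j hj => by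
          simp [hb2, hA j hj, hAW j hj]
        have e2 : ∀ j < n + 1, b2 (w j) = b (w j) := fun j hj => by
          simp [hb2, hW j hj, hWA j hj]
        have e3 : b2 (a (n + 1)) = xor (b (a (n + 1))) (b (a n)) := by
          simp [hb2, h1, hAW n (by omega)]
        rcases Nat.lt_succ_iff_lt_or_eq.1 hi with hi' | rfl
        · rw [Function.update_of_ne (hA i hi'), hfa _ i hi', e1 i hi',
            carryBit_congr (fun j hj => e1 j (by omega)) (fun j hj => e2 j (by omega))]
        · rw [Function.update_self, hfo _ _ (fun j hj => ⟨(hA j hj).symm, (hWA j hj).symm⟩), e3,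
            hfa _ n (by omega), hfw _ n (by omega), e1 n (by omega), e2 n (by omega),
            carryBit_congr (fun j hj => e1 j (by omega)) (fun j hj => e2 j (by omega)),
            Bool.xor_assoc]
          rfl
      · intro b i hi
        simp only [Equiv.trans_apply, xorPerm_apply]
        rcases Nat.lt_succ_iff_lt_or_eq.1 hi with hi' | rfl
        · rw [Function.update_of_ne (hWA i hi'), hfw _ i hi']
          simp [hA i hi', hAW i hi', hW i hi', hWA i hi']
        · rw [Function.update_of_ne h1.symm,
            hfo _ _ (fun j hj => ⟨(hAW j hj).symm, (hW j hj).symm⟩)]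
          simp [h1.symm]
      · intro b q hq
        simp only [Equiv.trans_apply, xorPerm_apply]
        have hq' := hq (n + 1) (by omega)
        rw [Function.update_of_ne hq'.1, hfo _ _ (fun j hj => hq j (by omega))]
        simp [hq'.1, hq'.2]

theorem exists_notLayer (w : ℕ → ι) (n : ℕ) (h : ∀ i < n, ∀ j < n, w i = w j → i = j) :
    ∃ f : Equiv.Perm (ι → Bool), Mp f n ∧ (∀ b, ∀ i < n, f b (w i) = !b (w i)) ∧
      (∀ b q, (∀ i < n, q ≠ w i) → f b q = b q) := by
  induction n with
  | zero => exact ⟨Equiv.refl _, Mp.refl, by simp, by simp⟩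
  | succ n ih =>
    obtain ⟨f, hf, hfw, hfo⟩ := ih fun i hi j hj => h i (by omega) j (by omega)
    have hW : ∀ i < n, w i ≠ w n := fun i hi e => by
      have := h _ (by omega) _ (by omega) e; omega
    refine ⟨_, hf.trans (Mp.not (w n)), ?_, ?_⟩
    · intro b i hi
      simp only [Equiv.trans_apply, xorPerm_apply]
      rcases Nat.lt_succ_iff_lt_or_eq.1 hi with hi' | rfl
      · rw [Function.update_of_ne (hW i hi'), hfw _ i hi']
      · rw [Function.update_self, hfo _ _ fun j hj => (hW j hj).symm]
        simp
    · intro b q hq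
      simp only [Equiv.trans_apply, xorPerm_apply]
      rw [Function.update_of_ne (hq n (by omega)), hfo _ _ fun j hj => hq j (by omega)]

theorem exists_cnotLayer (a w : ℕ → ι) (n : ℕ) (h : DistinctPair a w n) :
    ∃ f : Equiv.Perm (ι → Bool), Mp f n ∧
      (∀ b, ∀ i < n, f b (w i) = xor (b (w i)) (b (a i))) ∧
      (∀ b q, (∀ i < n, q ≠ w i) → f b q = b q) := by
  induction n with
  | zero => exact ⟨Equiv.refl _, Mp.refl, by simp, by simp⟩
  | succ n ih =>
    obtain ⟨f, hf, hfw, hfo⟩ := ih (h.mono (by omega))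
    have hW : ∀ i < n, w i ≠ w n := fun i hi e => by
      have := h.right _ (by omega) _ (by omega) e; omega
    refine ⟨_, hf.trans (Mp.cnot (h.disj n (by omega) n (by omega))), ?_, ?_⟩
    · intro b i hi
      simp only [Equiv.trans_apply, xorPerm_apply]
      rcases Nat.lt_succ_iff_lt_or_eq.1 hi with hi' | rfl
      · rw [Function.update_of_ne (hW i hi'), hfw _ i hi']
      · rw [Function.update_self, hfo _ _ fun j hj => (hW j hj).symm,
          hfo _ _ fun j hj => h.disj _ (by omega) _ (by omega)]
    · intro b q hq
      simp only [Equiv.trans_apply, xorPerm_apply]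
      rw [Function.update_of_ne (hq n (by omega)), hfo _ _ fun j hj => hq j (by omega)]

theorem exists_seqAdder (a w : ℕ → ι) (n : ℕ) (h : DistinctPair a w n) :
    ∃ f : Equiv.Perm (ι → Bool), Mp f (11 * n) ∧
      (∀ b, ∀ i < n, f b (w i) = xor (xor (b (a i)) (b (w i)))
        (carryBit (fun j => b (a j)) (fun j => b (w j)) i)) ∧
      (∀ b q, (∀ i < n, q ≠ w i) → f b q = b q) := by
  obtain ⟨f, hf, hfa, hfw, hfo⟩ := exists_carryChain a w n h
  obtain ⟨g, hg, hgw, hgo⟩ := exists_notLayer w n h.right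
  obtain ⟨c, hc, hcw, hco⟩ := exists_cnotLayer a w n h
  -- Replacing the second summand by the complement of the sum leaves every carry unchanged: with `s
  -- = x ⊕ y ⊕ c`, the majority of `x`, `¬s`, `c` equals that of `x`, `y`, `c`. Hence the inverse
  -- chain, run on the complemented register, restores `a` and leaves the complement of the sum in
  -- `w`.
  have key : ∀ b, ∀ i ≤ n,
      carryBit (fun j => f.symm (g (c (f b))) (a j)) (fun j => f.symm (g (c (f b))) (w j)) i =
        carryBit (fun j => b (a j)) (fun j => b (w j)) i ∧
      (i < n → f.symm (g (c (f b))) (a i) = b (a i) ∧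
        f.symm (g (c (f b))) (w i) = !(xor (xor (b (a i)) (b (w i)))
        (carryBit (fun j => b (a j)) (fun j => b (w j)) i))) := by
    intro b
    set u := f.symm (g (c (f b))) with hu
    have hfu : f u = g (c (f b)) := by rw [hu, Equiv.apply_symm_apply]
    intro i
    induction i with
    | zero =>
      intro _
      refine ⟨rfl, fun hi => ?_⟩
      have e1 := hfa u 0 hi
      have e2 := hfw u 0 hi
      rw [hfu, hgo _ _ (fun j hj => h.disj _ hi _ hj), hco _ _ (fun j hj => h.disj _ hi _ hj),
        hfa b 0 hi] at e1
      rw [hfu, hgw _ _ hi, hcw _ _ hi, hfa b 0 hi, hfw b 0 hi] at e2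
      simp only [carryBit, Bool.xor_false] at e1 e2 ⊢
      refine ⟨e1.symm, ?_⟩
      rw [← e1] at e2
      revert e2
      cases u (w 0) <;> cases b (a 0) <;> cases b (w 0) <;> simp
    | succ i ih =>
      intro hi
      obtain ⟨ih1, ih2⟩ := ih (by omega)
      obtain ⟨ih2, ih3⟩ := ih2 (by omega)
      have hc1 : carryBit (fun j => u (a j)) (fun j => u (w j)) (i + 1) =
          carryBit (fun j => b (a j)) (fun j => b (w j)) (i + 1) := by
        simp only [carryBit]
        rw [ih1, ih2, ih3]
        cases b (a i) <;> cases b (w i) <;>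
          cases carryBit (fun j => b (a j)) (fun j => b (w j)) i <;> rfl
      refine ⟨hc1, fun hi => ?_⟩
      have e1 := hfa u (i + 1) hi
      have e2 := hfw u (i + 1) hi
      rw [hfu, hgo _ _ (fun j hj => h.disj _ hi _ hj), hco _ _ (fun j hj => h.disj _ hi _ hj),
        hfa b _ hi, hc1] at e1
      rw [hfu, hgw _ _ hi, hcw _ _ hi, hfa b _ hi, hfw b _ hi] at e2
      have e3 : u (a (i + 1)) = b (a (i + 1)) := by
        revert e1
        cases u (a (i + 1)) <;> cases b (a (i + 1)) <;> simp
      refine ⟨e3, ?_⟩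
      rw [e3] at e2
      revert e2
      cases u (w (i + 1)) <;> cases b (a (i + 1)) <;> cases b (w (i + 1)) <;>
        cases carryBit (fun j => b (a j)) (fun j => b (w j)) (i + 1) <;> simp
  refine ⟨_, ((((hf.trans hc).trans hg).trans hf.symm).trans hg).mono (by omega), ?_, ?_⟩
  · intro b i hi
    simp only [Equiv.trans_apply]
    rw [hgw _ _ hi, ((key b i hi.le).2 hi).2, Bool.not_not]
  · intro b q hq
    simp only [Equiv.trans_apply]
    rw [hgo _ _ hq]
    by_cases hqa : ∃ i, i < n ∧ q = a i
    · obtain ⟨i, hi, rfl⟩ := hqa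
      exact ((key b i hi.le).2 hi).1
    · have hq' : ∀ i < n, q ≠ a i ∧ q ≠ w i :=
        fun i hi => ⟨fun e => hqa ⟨i, hi, e⟩, hq i hi⟩
      rw [← hfo (f.symm (g (c (f b)))) q hq', Equiv.apply_symm_apply, hgo _ _ hq, hco _ _ hq, hfo _ _ hq']

theorem Mp.xor_carryBit (a w : ℕ → ι) (n : ℕ) (h : DistinctPair a w n) (g : ι)
    (hg : ∀ i < n, g ≠ a i ∧ g ≠ w i)
    (hc : ∀ (b : ι → Bool) v, carryBit (fun j => Function.update b g v (a j))
      (fun j => Function.update b g v (w j)) n = carryBit (fun j => b (a j)) (fun j => b (w j)) n) :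
    Mp (xorPerm (fun b : ι → Bool => carryBit (fun j => b (a j)) (fun j => b (w j)) n) g hc) (10 * n) := by
  rcases n with _ | n
  · refine Mp.refl.congr ?_
    ext b q
    simp [xorPerm_apply, carryBit]
  · obtain ⟨f, hf, hfa, hfw, hfo⟩ := exists_carryChain a w (n + 1) h
    have h1 : a n ≠ g := ((hg n (by omega)).1).symm
    have h2 : w n ≠ g := ((hg n (by omega)).2).symm
    have h3 : a n ≠ w n := h.disj _ (by omega) _ (by omega)
    -- The chain provides the two factors of the top carry; the CNOT, taken before the chain,
    -- provides its linear term. Undoing the chain restores both registers because `g` lies outside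
    -- them.
    have := (((Mp.cnot h1).trans hf).trans (Mp.toffoli h3 h1 h2)).trans hf.symm
    refine (this.mono (N' := 10 * (n + 1)) (by omega)).congr ?_
    refine Equiv.ext fun b => ?_
    simp only [Equiv.trans_apply]
    rw [Equiv.symm_apply_eq]
    have eA : ∀ (v : Bool), ∀ i < n + 1, Function.update b g v (a i) = b (a i) := fun v i hi => by
      rw [Function.update_of_ne ((hg i hi).1).symm]
    have eW : ∀ (v : Bool), ∀ i < n + 1, Function.update b g v (w i) = b (w i) := fun v i hi => by
      rw [Function.update_of_ne ((hg i hi).2).symm]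
    have eC : ∀ (v : Bool), ∀ i < n + 1, carryBit (fun j => Function.update b g v (a j))
        (fun j => Function.update b g v (w j)) i =
        carryBit (fun j => b (a j)) (fun j => b (w j)) i := fun v i hi =>
      carryBit_congr (fun j hj => eA v j (by omega)) (fun j hj => eW v j (by omega))
    simp only [xorPerm_apply]
    funext q
    by_cases hqg : q = g
    · subst hqg
      rw [Function.update_self, hfo _ _ hg, hfo _ _ hg, Function.update_self, Function.update_self,
        hfa _ n (by omega), hfw _ n (by omega), eA _ n (by omega), eW _ n (by omega),
        eC _ n (by omega), Bool.xor_assoc]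
      rfl
    · rw [Function.update_of_ne hqg]
      by_cases hqa : ∃ i, i < n + 1 ∧ q = a i
      · obtain ⟨i, hi, rfl⟩ := hqa
        rw [hfa _ i hi, hfa _ i hi, eA _ i hi, eA _ i hi, eC _ i hi, eC _ i hi]
      · by_cases hqw : ∃ i, i < n + 1 ∧ q = w i
        · obtain ⟨i, hi, rfl⟩ := hqw
          rw [hfw _ i hi, hfw _ i hi, eA _ i hi, eA _ i hi, eW _ i hi, eW _ i hi]
        · have hq' : ∀ i < n + 1, q ≠ a i ∧ q ≠ w i :=
            fun i hi => ⟨fun e => hqa ⟨i, hi, e⟩, fun e => hqw ⟨i, hi, e⟩⟩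
          rw [hfo _ _ hq', hfo _ _ hq', Function.update_of_ne hqg, Function.update_of_ne hqg]

theorem sum_toNat_lt (x : ℕ → Bool) (n : ℕ) :
    ∑ i ∈ Finset.range n, (x i).toNat * 2 ^ i < 2 ^ n := by
  induction n with
  | zero => simp
  | succ n ih =>
    rw [Finset.sum_range_succ, pow_succ]
    have : (x n).toNat * 2 ^ n ≤ 1 * 2 ^ n := Nat.mul_le_mul_right _ (Bool.toNat_le _)
    omega

/-- A register, continued by the qubit `g`. -/
def extendReg {ι : Type} {n : ℕ} (a : Fin n → ι) (g : ι) (i : ℕ) : ι :=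
  if h : i < n then a ⟨i, h⟩ else g

theorem extendReg_of_lt {ι : Type} {n : ℕ} (a : Fin n → ι) (g : ι) {i : ℕ} (h : i < n) :
    extendReg a g i = a ⟨i, h⟩ := dif_pos h

theorem sum_extendReg {ι : Type} {n : ℕ} (a : Fin n → ι) (g : ι) (b : ι → Bool) :
    ∑ i ∈ Finset.range n, (b (extendReg a g i)).toNat * 2 ^ i = val fun i => b (a i) := by
  rw [Finset.sum_range, val]
  exact Finset.sum_congr rfl fun i _ => by rw [extendReg_of_lt a g i.2]

theorem val_congr {ι : Type} {r : ℕ} {a : Fin r → ι} {b b' : ι → Bool}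
    (h : ∀ i, b (a i) = b' (a i)) : (val fun i => b (a i)) = val fun i => b' (a i) := by
  simp [val, h]

/-- The registers `a` and `c` have no qubit in common. -/
def Disj {ι : Type} {r t : ℕ} (a : Fin r → ι) (c : Fin t → ι) : Prop := ∀ i j, a i ≠ c j

theorem Disj.symm {ι : Type} {r t : ℕ} {a : Fin r → ι} {c : Fin t → ι} (h : Disj a c) :
    Disj c a := fun i j e => h j i e.symm

theorem distinctPair_extendReg {ι : Type} {n : ℕ} {a w : Fin n → ι} (ha : a.Injective)
    (hw : w.Injective) (h : Disj a w) (g : ι) :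
    DistinctPair (extendReg a g) (extendReg w g) n := by
  refine ⟨fun i hi j hj e => ?_, fun i hi j hj e => ?_, fun i hi j hj => ?_⟩
  · rw [extendReg_of_lt _ _ hi, extendReg_of_lt _ _ hj] at e
    simpa using ha e
  · rw [extendReg_of_lt _ _ hi, extendReg_of_lt _ _ hj] at e
    simpa using hw e
  · rw [extendReg_of_lt _ _ hi, extendReg_of_lt _ _ hj]
    exact h _ _

/-- The carry bit of the sum of two registers. -/
def carry {ι : Type} {n : ℕ} (a w : Fin n → ι) (b : ι → Bool) : Bool :=
  decide (2 ^ n ≤ (val fun i => b (a i)) + val fun i => b (w i))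

theorem carryBit_extendReg {ι : Type} {n : ℕ} (a w : Fin n → ι) (g : ι) (b : ι → Bool) :
    carryBit (fun j => b (extendReg a g j)) (fun j => b (extendReg w g j)) n = carry a w b := by
  have h1 := sum_add_carryBit (fun j => b (extendReg a g j)) (fun j => b (extendReg w g j)) n
  have h2 := sum_toNat_lt (fun i => xor (xor (b (extendReg a g i)) (b (extendReg w g i)))
    (carryBit (fun j => b (extendReg a g j)) (fun j => b (extendReg w g j)) i)) n
  rw [sum_extendReg, sum_extendReg] at h1
  unfold carry
  rw [← h1]
  symm
  cases carryBit (fun j => b (extendReg a g j)) (fun j => b (extendReg w g j)) n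
  · simpa using h2
  · simp

theorem exists_adder {n : ℕ} {a w : Fin n → ι} (ha : a.Injective) (hw : w.Injective)
    (h : Disj a w) : ∃ f : Equiv.Perm (ι → Bool), Mp f (11 * n) ∧
      (∀ b, rval w (f b) + 2 ^ n * ((carry a w b).toNat : ℝ) = rval w b + rval a b) ∧
      (∀ b q, (∀ i, q ≠ w i) → f b q = b q) := by
  rcases n with _ | n
  · exact ⟨Equiv.refl _, Mp.refl, by simp [rval, val, carry], by simp⟩
  -- The qubit `a 0` is merely the default value of the two sequences beyond the registers.
  · obtain ⟨f, hf, hfw, hfo⟩ := exists_seqAdder _ _ _ (distinctPair_extendReg ha hw h (a 0))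
    refine ⟨f, hf, fun b => ?_, fun b q hq => hfo b q fun i hi => ?_⟩
    · have h1 := sum_add_carryBit (fun j => b (extendReg a (a 0) j))
        (fun j => b (extendReg w (a 0) j)) (n + 1)
      rw [sum_extendReg, sum_extendReg, carryBit_extendReg] at h1
      have h2 : ∑ i ∈ Finset.range (n + 1), (xor (xor (b (extendReg a (a 0) i))
          (b (extendReg w (a 0) i))) (carryBit (fun j => b (extendReg a (a 0) j))
          (fun j => b (extendReg w (a 0) j)) i)).toNat * 2 ^ i = val fun i => f b (w i) := by
        rw [← sum_extendReg w (a 0)]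
        exact Finset.sum_congr rfl fun i hi => by rw [hfw b i (Finset.mem_range.1 hi)]
      rw [h2] at h1
      have h3 : ((val fun i => f b (w i) : ℕ) : ℝ) + ((carry a w b).toNat : ℝ) * 2 ^ (n + 1)
          = (val fun i => b (a i) : ℕ) + (val fun i => b (w i) : ℕ) := by exact_mod_cast h1
      simp only [rval]
      linarith
    · rw [extendReg_of_lt _ _ hi]
      exact hq _

theorem Mp.xor_carry {n : ℕ} {a w : Fin n → ι} (ha : a.Injective) (hw : w.Injective)
    (h : Disj a w) (g : ι) (hg : ∀ i, g ≠ a i ∧ g ≠ w i)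
    (hc : ∀ (b : ι → Bool) v, carry a w (Function.update b g v) = carry a w b) :
    Mp (xorPerm (carry a w) g hc) (10 * n) := by
  have hc' : ∀ (b : ι → Bool) v, carryBit (fun j => Function.update b g v (extendReg a g j))
      (fun j => Function.update b g v (extendReg w g j)) n =
      carryBit (fun j => b (extendReg a g j)) (fun j => b (extendReg w g j)) n := fun b v => by
    rw [carryBit_extendReg, carryBit_extendReg, hc]
  refine (Mp.xor_carryBit _ _ _ (distinctPair_extendReg ha hw h g) g (fun i hi => ?_) hc').congr ?_
  · rw [extendReg_of_lt _ _ hi, extendReg_of_lt _ _ hi]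
    exact hg _
  · ext b q
    simp only [xorPerm_apply, carryBit_extendReg]

/-! ### Controlled phases from uncontrolled ones -/

/-- The bit `c`, a function of the qubits in `Q`, can be used as a control at the cost of `N`
gates: it can be added to any qubit outside `Q`, and it can be given any phase. -/
structure Ctl (c : (ι → Bool) → Bool) (Q : Set ι) (N : ℕ) : Prop where
  dep : ∀ b b' : ι → Bool, (∀ q ∈ Q, b q = b' q) → c b = c b'
  flip : ∀ g, g ∉ Q → ∀ h, Mp (xorPerm c g h) N
  phase : ∀ α : ℝ, Ph (fun b => α * ((c b).toNat : ℝ)) N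

theorem Ctl.bit (j : ι) : Ctl (fun b : ι → Bool => b j) {j} 1 where
  dep _ _ h := h j rfl
  flip g hg _ := Mp.cnot (c := j) (i := g) fun e => hg e.symm
  phase α := Ph.bit α j

theorem Ctl.carry {n : ℕ} {a w : Fin n → ι} (ha : a.Injective) (hw : w.Injective)
    (h : Disj a w) : Ctl (carry a w) (Set.range a ∪ Set.range w) (25 * n) where
  dep b b' hb := by
    unfold QMul.carry
    rw [val_congr (a := a) fun i => hb _ (Or.inl ⟨i, rfl⟩),
      val_congr (a := w) fun i => hb _ (Or.inr ⟨i, rfl⟩)]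
  flip g hg hc := (Mp.xor_carry ha hw h g (fun i =>
    ⟨fun e => hg (Or.inl ⟨i, e.symm⟩), fun e => hg (Or.inr ⟨i, e.symm⟩)⟩) hc).mono (by omega)
  phase α := by
    obtain ⟨f, hf, hfw, -⟩ := exists_adder ha hw h
    -- The carry equals `(a + w - w') / 2 ^ n`, where `w'` is the register after the addition. Three
    -- linear phases and one conjugation by the adder give `3n + 22n` gates.
    refine (((Ph.linear (α / 2 ^ n) a).add (Ph.linear (α / 2 ^ n) w)).add
      ((Ph.linear (-(α / 2 ^ n)) w).conj hf)).mono (by omega) |>.congr fun b => ?_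
    have := hfw b
    field_simp
    linear_combination α * this

theorem exists_fanout (g : ι) {n : ℕ} (t : Fin n → ι) (ht : t.Injective) (hg : ∀ i, g ≠ t i) :
    ∃ f : Equiv.Perm (ι → Bool), Mp f n ∧ (∀ b i, f b (t i) = xor (b (t i)) (b g)) ∧
      (∀ b q, (∀ i, q ≠ t i) → f b q = b q) := by
  induction n with
  | zero => exact ⟨Equiv.refl _, Mp.refl, fun _ i => i.elim0, by simp⟩
  | succ n ih =>
    obtain ⟨f, hf, hft, hfo⟩ := ih (fun i => t i.castSucc)
      (ht.comp (Fin.castSucc_injective n)) fun i => hg _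
    have hne : ∀ i : Fin n, t i.castSucc ≠ t (Fin.last n) := fun i e =>
      (Fin.castSucc_lt_last i).ne (ht e)
    refine ⟨_, hf.trans (Mp.cnot (hg (Fin.last n))), fun b i => ?_, fun b q hq => ?_⟩
    · simp only [Equiv.trans_apply, xorPerm_apply]
      induction i using Fin.lastCases with
      | last => rw [Function.update_self, hfo b g fun i => hg _, hfo b _ fun i => (hne i).symm]
      | cast i => rw [Function.update_of_ne (hne i), hft]
    · simp only [Equiv.trans_apply, xorPerm_apply]
      rw [Function.update_of_ne (hq _), hfo _ _ fun i => hq _]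

/-- A whole register is complemented if `c` is `1`; the qubits of the register serve as borrowed
qubits. -/
theorem Ctl.exists_flipReg {c : (ι → Bool) → Bool} {Q : Set ι} {N : ℕ} (hc : Ctl c Q N) {s : ℕ}
    {S : Fin s → ι} (hS : S.Injective) (hSQ : ∀ i, S i ∉ Q) :
    ∃ f : Equiv.Perm (ι → Bool), Mp f (2 * s + N) ∧
      (∀ b i, f b (S i) = xor (b (S i)) (c b)) ∧ (∀ b q, (∀ i, q ≠ S i) → f b q = b q) := by
  rcases s with _ | s
  · exact ⟨Equiv.refl _, Mp.refl.mono (by omega), fun _ i => i.elim0, by simp⟩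
  · have h0 : ∀ i : Fin s, S 0 ≠ S i.succ := fun i e => Fin.succ_ne_zero i (hS e).symm
    obtain ⟨f, hf, hft, hfo⟩ := exists_fanout (S 0) (fun i => S i.succ)
      (hS.comp (Fin.succ_injective s)) h0
    have hd : ∀ (b : ι → Bool) v, c (Function.update b (S 0) v) = c b := fun b v =>
      hc.dep _ _ fun q hq => Function.update_of_ne (by rintro rfl; exact hSQ 0 hq) _ _
    have hcf : ∀ b, c (f b) = c b := fun b => hc.dep _ _ fun q hq =>
      hfo _ _ fun i e => hSQ i.succ (e ▸ hq)
    -- Between two identical fan-outs of `S 0`, adding `c` to `S 0` alone reaches every qubit: the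
    -- old value of `S 0` cancels and `c` remains.
    refine ⟨_, ((hf.trans (hc.flip (S 0) (hSQ 0) hd)).trans hf).mono (by omega),
      fun b i => ?_, fun b q hq => ?_⟩
    · simp only [Equiv.trans_apply, xorPerm_apply]
      induction i using Fin.cases with
      | zero => rw [hfo _ _ h0, Function.update_self, hfo _ _ h0, hcf]
      | succ i =>
        rw [hft, Function.update_self, Function.update_of_ne (h0 i).symm, hft, hfo _ _ h0, hcf]
        cases b (S i.succ) <;> cases b (S 0) <;> cases c b <;> rfl
    · simp only [Equiv.trans_apply, xorPerm_apply]
      rw [hfo _ _ fun i => hq _, Function.update_of_ne (hq _), hfo _ _ fun i => hq _]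

theorem rval_not {ι : Type} {s : ℕ} (S : Fin s → ι) (b b' : ι → Bool)
    (h : ∀ i, b' (S i) = !b (S i)) : rval S b' = 2 ^ s - 1 - rval S b := by
  have : rval S b' + rval S b = ∑ i : Fin s, (2 : ℝ) ^ (i : ℕ) := by
    rw [rval_eq, rval_eq, ← Finset.sum_add_distrib]
    refine Finset.sum_congr rfl fun i _ => ?_
    rw [h i]
    cases b (S i) <;> simp
  rw [Fin.sum_univ_eq_sum_range (fun i => (2 : ℝ) ^ i), geom_sum_eq (by norm_num)] at this
  linarith

/-- `H` does not depend on the qubits of the register `S`. -/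
def Indep {ι : Type} {s : ℕ} (H : (ι → Bool) → ℝ) (S : Fin s → ι) : Prop :=
  ∀ b b' : ι → Bool, (∀ q, (∀ i, q ≠ S i) → b q = b' q) → H b = H b'

theorem Disj.indep {ι : Type} {r t : ℕ} {a : Fin r → ι} {c : Fin t → ι} (h : Disj a c) :
    Indep (rval a) c := fun _ _ hb => rval_congr fun i => hb _ fun j => h i j

theorem Indep.const {ι : Type} {s : ℕ} (S : Fin s → ι) (x : ℝ) : Indep (fun _ => x) S :=
  fun _ _ _ => rfl

theorem Indep.mul {ι : Type} {s : ℕ} {S : Fin s → ι} {H H' : (ι → Bool) → ℝ} (h : Indep H S)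
    (h' : Indep H' S) : Indep (fun b => H b * H' b) S := fun b b' hb => by
  simp only [h b b' hb, h' b b' hb]

theorem Indep.sum {ι : Type} {s : ℕ} {S : Fin s → ι} {J : Type*} (u : Finset J)
    {H : J → (ι → Bool) → ℝ} (h : ∀ j ∈ u, Indep (H j) S) : Indep (fun b => ∑ j ∈ u, H j b) S :=
  fun b b' hb => Finset.sum_congr rfl fun j hj => h j hj b b' hb

/-- A controlled phase from the uncontrolled one, by complementing a register. -/
theorem Ctl.mul_reg {c : (ι → Bool) → Bool} {Q : Set ι} {N P P' : ℕ} (hc : Ctl c Q N) {s : ℕ}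
    {S : Fin s → ι} (hS : S.Injective) (hSQ : ∀ i, S i ∉ Q) {H : (ι → Bool) → ℝ}
    (hH : Indep H S) (h1 : ∀ α : ℝ, Ph (fun b => α * rval S b * H b) P)
    (h2 : ∀ α : ℝ, Ph (fun b => α * ((c b).toNat : ℝ) * H b) P') (α : ℝ) :
    Ph (fun b => α * ((c b).toNat : ℝ) * rval S b * H b) (2 * P + P' + 2 * (2 * s + N)) := by
  obtain ⟨f, hf, hfS, hfo⟩ := hc.exists_flipReg hS hSQ
  -- If `x'` is the conditionally complemented value, `x - x'` is `0` for `c = 0` and `2x - (2 ^ s -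
  -- 1)` for `c = 1`. Half of this is `c x` up to a constant multiple of `c`, which the third phase
  -- restores.
  refine ((((h1 (-(α / 2))).conj hf).add (h1 (α / 2))).add (h2 (α / 2 * (2 ^ s - 1)))).mono
    (by omega) |>.congr fun b => ?_
  rw [hH (f b) b fun q hq => hfo b q hq]
  cases hb : c b with
  | false =>
    rw [rval_congr (b := f b) (b' := b) fun i => by rw [hfS, hb, Bool.xor_false]]
    simp
  | true =>
    rw [rval_not S b (f b) fun i => by rw [hfS, hb, Bool.xor_true]]
    simp only [Bool.toNat_true, Nat.cast_one]
    ring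

theorem Ctl.linear {c : (ι → Bool) → Bool} {Q : Set ι} {N : ℕ} (hc : Ctl c Q N) {s : ℕ}
    {S : Fin s → ι} (hS : S.Injective) (hSQ : ∀ i, S i ∉ Q) (α : ℝ) :
    Ph (fun b => α * ((c b).toNat : ℝ) * rval S b) (6 * s + 3 * N) :=
  ((hc.mul_reg hS hSQ (Indep.const S 1) (fun α => (Ph.linear α S).congr fun b => by ring)
    (fun α => (hc.phase α).congr fun b => by ring) α).mono (by omega)).congr fun b => by ring

theorem Ctl.product {c : (ι → Bool) → Bool} {Q : Set ι} {N P : ℕ} (hc : Ctl c Q N) {s t : ℕ}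
    {S : Fin s → ι} {T : Fin t → ι} (hS : S.Injective) (hSQ : ∀ i, S i ∉ Q) (hT : T.Injective)
    (hTQ : ∀ i, T i ∉ Q) (hST : Disj S T) (hP : ∀ α : ℝ, Ph (fun b => α * rval S b * rval T b) P)
    (α : ℝ) :
    Ph (fun b => α * ((c b).toNat : ℝ) * rval S b * rval T b)
      (2 * P + 4 * s + 6 * t + 5 * N) :=
  (hc.mul_reg hS hSQ hST.symm.indep hP (hc.linear hT hTQ) α).mono (by omega)

/-! ### Linear forms in the phase, with overflow corrections -/

/-- Addition of a register to the low qubits of a register that is not shorter; the carry is not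
propagated. -/
theorem exists_lowAdder {l' l : ℕ} (hl : l' ≤ l) {a : Fin l' → ι} {w : Fin l → ι}
    (ha : a.Injective) (hw : w.Injective) (h : Disj a w) :
    ∃ f : Equiv.Perm (ι → Bool), Mp f (11 * l') ∧
      (∀ b, rval w (f b) + 2 ^ l' * ((carry a (fun i => w (Fin.castLE hl i)) b).toNat : ℝ) =
        rval w b + rval a b) ∧
      (∀ b q, (∀ i, q ≠ w i) → f b q = b q) := by
  obtain ⟨e, rfl⟩ := Nat.exists_eq_add_of_le hl
  obtain ⟨f, hf, hfw, hfo⟩ := exists_adder (w := fun i => w (Fin.castLE hl i)) ha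
    (hw.comp (Fin.castLE_injective hl)) fun i j => h i _
  refine ⟨f, hf, fun b => ?_, fun b q hq => hfo b q fun i => hq _⟩
  have split : ∀ b : ι → Bool, rval w b = rval (fun i => w (Fin.castLE hl i)) b +
      ∑ i : Fin e, ((b (w (Fin.natAdd l' i))).toNat : ℝ) * 2 ^ (l' + i : ℕ) := fun b => by
    rw [rval_eq, rval_eq, Fin.sum_univ_add]
    rfl
  have hup : ∀ i : Fin e, f b (w (Fin.natAdd l' i)) = b (w (Fin.natAdd l' i)) := fun i =>
    hfo b _ fun j e => by
      have := congrArg Fin.val (hw e)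
      simp at this
      omega
  rw [split (f b), split b]
  simp only [hup]
  linarith [hfw b]

/-- Each conjugation by the truncated adder replaces `w` by `w + a - 2 ^ l' * carry`. The carry term
is compensated by a controlled phase of `H`, so `w` needs no room for the sum. -/
theorem Ph.add_multiple {l : ℕ} {w : Fin l → ι} {H R : (ι → Bool) → ℝ} (hH : Indep H w)
    (hR : Indep R w) {l' : ℕ} (hl : l' ≤ l) {a : Fin l' → ι} (ha : a.Injective)
    (hw : w.Injective) (h : Disj a w) {N N' : ℕ}
    (hcorr : ∀ α : ℝ,
      Ph (fun b => α * ((carry a (fun i => w (Fin.castLE hl i)) b).toNat : ℝ) * H b) N')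
    (hbase : Ph (fun b => (rval w b + R b) * H b) N) (z : ℤ) :
    Ph (fun b => (rval w b + (R b + z * rval a b)) * H b) (N + z.natAbs * (N' + 22 * l')) := by
  obtain ⟨f, hf, hfw, hfo⟩ := exists_lowAdder hl ha hw h
  have haf : ∀ b, rval a (f b) = rval a b := fun b => h.indep _ _ (hfo b)
  have hHf : ∀ b, H (f b) = H b := fun b => hH _ _ (hfo b)
  have hRf : ∀ b, R (f b) = R b := fun b => hR _ _ (hfo b)
  rcases Int.natAbs_eq z with hz | hz <;> rw [hz] <;> generalize z.natAbs = m <;> clear hz z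
  · induction m with
    | zero => exact hbase.congr (fun b => by simp) |>.mono (by omega)
    | succ m ih =>
      -- The carry here is that of the state before the addition, so its correction stays outside
      -- the conjugation.
      refine ((ih.conj hf).add (hcorr (2 ^ l'))).mono ?_ |>.congr fun b => ?_
      · simp only [Int.natAbs_natCast, add_mul]; omega
      · have h1 := hfw b
        simp only [hHf, hRf, haf]
        push_cast
        linear_combination (- H b) * h1
  · induction m with
    | zero => exact hbase.congr (fun b => by simp) |>.mono (by omega)
    | succ m ih =>
      -- For subtraction, the carry is that of the state after the inverse adder, so the correction
      -- goes inside the conjugation.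
      refine ((ih.add (hcorr (-(2 ^ l')))).conj hf.symm).mono ?_ |>.congr fun b => ?_
      · simp only [Int.natAbs_neg, Int.natAbs_natCast, add_mul]; omega
      · have h1 := hfw (f.symm b)
        have h2 := haf (f.symm b)
        have h3 := hHf (f.symm b)
        have h4 := hRf (f.symm b)
        rw [Equiv.apply_symm_apply] at h1 h2 h3 h4
        rw [← h2] at h1
        rw [← h2, ← h3, ← h4]
        push_cast
        linear_combination (H b) * h1

/-- The phase `(w + ∑ zⱼ aⱼ) H` from the phase `w H` and the phases of the carries. -/
theorem Ph.accumulate {l : ℕ} {w : Fin l → ι} (hw : w.Injective) {H : (ι → Bool) → ℝ}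
    (hH : Indep H w) {J : Type*} (s : Finset J) {len : J → ℕ} (hl : ∀ j, len j ≤ l)
    {a : (j : J) → Fin (len j) → ι} (ha : ∀ j ∈ s, (a j).Injective) (h : ∀ j ∈ s, Disj (a j) w)
    {N N' : ℕ} (hcorr : ∀ j ∈ s, ∀ α : ℝ,
      Ph (fun b => α * ((carry (a j) (fun i => w (Fin.castLE (hl j) i)) b).toNat : ℝ) * H b) N')
    (hbase : Ph (fun b => rval w b * H b) N) (z : J → ℤ) :
    Ph (fun b => (rval w b + ∑ j ∈ s, z j * rval (a j) b) * H b)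
      (N + (∑ j ∈ s, (z j).natAbs) * (N' + 22 * l)) := by
  classical
  induction s using Finset.induction_on with
  | empty => exact hbase.congr (fun b => by simp) |>.mono (by omega)
  | insert j s hj ih =>
    have ih' := ih (fun i hi => ha i (Finset.mem_insert_of_mem hi))
      (fun i hi => h i (Finset.mem_insert_of_mem hi))
      (fun i hi => hcorr i (Finset.mem_insert_of_mem hi))
    have hj' := Finset.mem_insert_self j s
    have := Ph.add_multiple hH (Indep.sum s fun i hi => (Indep.const w (z i : ℝ)).mul
      (h i (Finset.mem_insert_of_mem hi)).indep) (hl j) (ha j hj') hw (h j hj') (hcorr j hj') ih'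
      (z j)
    refine (this.congr fun b => ?_).mono ?_
    · rw [Finset.sum_insert hj]; ring
    · rw [Finset.sum_insert hj, add_mul]
      have := Nat.mul_le_mul_left (z j).natAbs
        (Nat.add_le_add_left (Nat.mul_le_mul_left 22 (hl j)) N')
      omega

/-- Disjoint registers, the digits of one number; none is longer than the digit `j₀` and than
`M`. -/
structure Digits {k : ℕ} {len : Fin k → ℕ} (j₀ : Fin k) (X : (i : Fin k) → Fin (len i) → ι)
    (M : ℕ) : Prop where
  inj : ∀ i, (X i).Injective
  disj : ∀ i j, i ≠ j → Disj (X i) (X j)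
  len_le : ∀ i, len i ≤ len j₀
  len_bound : len j₀ ≤ M

/-- A linear form in the digits. -/
def digitForm {ι : Type} {k : ℕ} {len : Fin k → ℕ} (X : (i : Fin k) → Fin (len i) → ι)
    (a : Fin k → ℤ) (b : ι → Bool) : ℝ := ∑ i, a i * rval (X i) b

/-- The digit `j₀` serves as accumulator. It has coefficient `1`, and no digit is longer, so each of
the others can be added to its low qubits. -/
theorem Digits.ph_form {k : ℕ} {len : Fin k → ℕ} {j₀ : Fin k}
    {X : (i : Fin k) → Fin (len i) → ι} {M : ℕ} (hX : Digits j₀ X M) {a : Fin k → ℤ}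
    (ha : a j₀ = 1) {H : (ι → Bool) → ℝ} (hH : Indep H (X j₀)) {N N' : ℕ}
    (hcorr : ∀ (c : (ι → Bool) → Bool) (Q : Set ι), Ctl c Q (25 * M) →
      (∀ q ∈ Q, ∃ i j, X i j = q) → ∀ α : ℝ, Ph (fun b => α * ((c b).toNat : ℝ) * H b) N')
    (hbase : Ph (fun b => rval (X j₀) b * H b) N) :
    Ph (fun b => digitForm X a b * H b) (N + (∑ i, (a i).natAbs) * (N' + 22 * M)) := by
  have key := Ph.accumulate (hX.inj j₀) hH (Finset.univ.erase j₀) hX.len_le (fun i _ => hX.inj i)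
    (fun i hi => hX.disj i j₀ (Finset.ne_of_mem_erase hi)) (N' := N') (fun i hi α => by
      have hc := Ctl.carry (hX.inj i)
        ((hX.inj j₀).comp (Fin.castLE_injective (hX.len_le i)))
        (fun u v => hX.disj i j₀ (Finset.ne_of_mem_erase hi) u _)
      have hle : 25 * len i ≤ 25 * M :=
        Nat.mul_le_mul_left _ ((hX.len_le i).trans hX.len_bound)
      refine hcorr _ _ ⟨hc.dep, fun g hg h => (hc.flip g hg h).mono hle,
        fun α => (hc.phase α).mono hle⟩ ?_ α
      rintro q (⟨u, rfl⟩ | ⟨u, rfl⟩)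
      · exact ⟨i, u, rfl⟩
      · exact ⟨j₀, _, rfl⟩) hbase a
  refine (key.congr fun b => ?_).mono ?_
  · rw [digitForm, ← Finset.add_sum_erase _ _ (Finset.mem_univ j₀), ha]
    simp
  · refine Nat.add_le_add_left (Nat.mul_le_mul ?_ ?_) _
    · exact Finset.sum_le_sum_of_subset (Finset.subset_univ _)
    · have := hX.len_bound
      omega

theorem Digits.indep_form {k : ℕ} {len len' : Fin k → ℕ} {X : (i : Fin k) → Fin (len i) → ι}
    {Z : (i : Fin k) → Fin (len' i) → ι} (h : ∀ i j, Disj (X i) (Z j)) (a : Fin k → ℤ)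
    (j : Fin k) : Indep (digitForm X a) (Z j) :=
  Indep.sum _ fun i _ => (Indep.const _ _).mul (h i j).indep

/-- Products of two registers of at most `M` qubits are put into the phase by at most `P`
gates. -/
def PPBound (M P : ℕ) : Prop :=
  ∀ (ι : Type) [Fintype ι] [DecidableEq ι] (r t : ℕ) (a : Fin r → ι) (c : Fin t → ι),
    r ≤ M → t ≤ M → a.Injective → c.Injective → Disj a c → ∀ φ : ℝ,
      Ph (fun b => φ * rval a b * rval c b) P

/-- Products of three registers of at most `M` qubits are put into the phase by at most `P`
gates. -/
def PTPBound (M P : ℕ) : Prop :=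
  ∀ (ι : Type) [Fintype ι] [DecidableEq ι] (r s t : ℕ) (a : Fin r → ι) (c : Fin s → ι)
    (e : Fin t → ι), r ≤ M → s ≤ M → t ≤ M → a.Injective → c.Injective → e.Injective →
      Disj a c → Disj a e → Disj c e → ∀ φ : ℝ,
        Ph (fun b => φ * rval a b * rval c b * rval e b) P

theorem Digits.le {k : ℕ} {len : Fin k → ℕ} {j₀ : Fin k}
    {X : (i : Fin k) → Fin (len i) → ι} {M : ℕ} (hX : Digits j₀ X M) (i : Fin k) : len i ≤ M :=
  (hX.len_le i).trans hX.len_bound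

/-- The factors are enlarged one at a time. A carry in `Z` multiplies one digit of `X`; a carry in
`X` then multiplies the form in `Z`, that is `k` digits. Each term is a controlled linear phase of
at most `6M + 3 * 25M = 81M` gates. -/
theorem ph_form_mul_form {k : ℕ} {lx lz : Fin k → ℕ} {j₀ : Fin k}
    {X : (i : Fin k) → Fin (lx i) → ι} {Z : (i : Fin k) → Fin (lz i) → ι} {M N K : ℕ}
    (hX : Digits j₀ X M) (hZ : Digits j₀ Z M) (hXZ : ∀ i j, Disj (X i) (Z j)) {a : Fin k → ℤ}
    (ha : a j₀ = 1) (hK : ∑ i, (a i).natAbs ≤ K) {φ : ℝ}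
    (hbase : Ph (fun b => φ * rval (X j₀) b * rval (Z j₀) b) N) :
    Ph (fun b => φ * digitForm X a b * digitForm Z a b) (N + K * (81 * (k + 1) * M + 44 * M)) := by
  have h1 := hZ.ph_form ha (H := fun b => φ * rval (X j₀) b) (N' := 81 * M)
    ((Indep.const _ _).mul (hXZ j₀ j₀).indep)
    (fun c Q hc hQ α => ((hc.linear (hX.inj j₀) (fun i hi => by
        obtain ⟨u, v, e⟩ := hQ _ hi
        exact hXZ _ _ _ _ e.symm) (α * φ)).mono (by have := hX.le j₀; omega)).congr
      fun b => by ring)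
    (hbase.congr fun b => by ring)
  have h2 := hX.ph_form ha (H := fun b => φ * digitForm Z a b) (N' := k * (81 * M))
    ((Indep.const _ _).mul (Digits.indep_form (fun i j => (hXZ j i).symm) a j₀))
    (fun c Q hc hQ α => by
      have := Ph.sum Finset.univ (θ := fun (j : Fin k) b =>
          α * φ * a j * ((c b).toNat : ℝ) * rval (Z j) b) (N := 81 * M) fun j _ =>
        (hc.linear (hZ.inj j) (fun i hi => by
          obtain ⟨u, v, e⟩ := hQ _ hi
          exact hXZ _ _ _ _ e) (α * φ * a j)).mono (by have := hZ.le j; omega)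
      simp only [Finset.card_univ, Fintype.card_fin] at this
      refine this.congr fun b => ?_
      simp only [digitForm, Finset.mul_sum]
      exact Finset.sum_congr rfl fun i _ => by ring)
    (h1.congr fun b => by ring)
  refine (h2.congr fun b => by ring).mono ?_
  have e1 := Nat.mul_le_mul_right (81 * M + 22 * M) hK
  have e2 := Nat.mul_le_mul_right (k * (81 * M) + 22 * M) hK
  calc _ ≤ N + K * (81 * M + 22 * M) + K * (k * (81 * M) + 22 * M) := by omega
    _ = _ := by ring

/-- Enlarging `Z`, `Y`, `X` in turn, a carry multiplies `1`, `k` and `k * k` products of two digits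
respectively. Overflow thus costs only controlled two-factor phases; the three-factor phase occurs
once, in `hbase`. -/
theorem ph_form_mul_form_mul_form {k : ℕ} {lx ly lz : Fin k → ℕ} {j₀ : Fin k}
    {X : (i : Fin k) → Fin (lx i) → ι} {Y : (i : Fin k) → Fin (ly i) → ι}
    {Z : (i : Fin k) → Fin (lz i) → ι} {M N K P : ℕ}
    (hX : Digits j₀ X M) (hY : Digits j₀ Y M) (hZ : Digits j₀ Z M)
    (hXY : ∀ i j, Disj (X i) (Y j)) (hXZ : ∀ i j, Disj (X i) (Z j))
    (hYZ : ∀ i j, Disj (Y i) (Z j)) {a : Fin k → ℤ}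
    (ha : a j₀ = 1) (hK : ∑ i, (a i).natAbs ≤ K) (hP : PPBound M P) {φ : ℝ}
    (hbase : Ph (fun b => φ * rval (X j₀) b * rval (Y j₀) b * rval (Z j₀) b) N) :
    Ph (fun b => φ * digitForm X a b * digitForm Y a b * digitForm Z a b)
      (N + K * ((k * k + k + 1) * (2 * P + 135 * M) + 66 * M)) := by
  have prod : ∀ {s t : ℕ} (S : Fin s → ι) (T : Fin t → ι) (c : (ι → Bool) → Bool) (Q : Set ι),
      Ctl c Q (25 * M) → s ≤ M → t ≤ M → S.Injective → T.Injective → Disj S T →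
      (∀ i, S i ∉ Q) → (∀ i, T i ∉ Q) → ∀ α : ℝ,
      Ph (fun b => α * ((c b).toNat : ℝ) * rval S b * rval T b) (2 * P + 135 * M) :=
    fun S T c Q hc hs ht hS hT hST hSQ hTQ α =>
      (hc.product hS hSQ hT hTQ hST (fun β => hP ι _ _ S T hs ht hS hT hST β) α).mono (by omega)
  have h1 := hZ.ph_form ha (H := fun b => φ * rval (X j₀) b * rval (Y j₀) b)
    (N' := 2 * P + 135 * M)
    (((Indep.const _ _).mul (hXZ j₀ j₀).indep).mul (hYZ j₀ j₀).indep)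
    (fun c Q hc hQ α => (prod (X j₀) (Y j₀) c Q hc (hX.le _) (hY.le _) (hX.inj _) (hY.inj _)
      (hXY _ _) (fun i hi => by
        obtain ⟨u, v, e⟩ := hQ _ hi
        exact hXZ _ _ _ _ e.symm) (fun i hi => by
        obtain ⟨u, v, e⟩ := hQ _ hi
        exact hYZ _ _ _ _ e.symm) (α * φ)).congr fun b => by ring)
    (hbase.congr fun b => by ring)
  have h2 := hY.ph_form ha (H := fun b => φ * rval (X j₀) b * digitForm Z a b)
    (N' := k * (2 * P + 135 * M))
    (((Indep.const _ _).mul (hXY j₀ j₀).indep).mul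
      (Digits.indep_form (fun i j => (hYZ j i).symm) a j₀))
    (fun c Q hc hQ α => by
      have := Ph.sum Finset.univ (θ := fun (j : Fin k) b =>
          α * φ * a j * ((c b).toNat : ℝ) * rval (X j₀) b * rval (Z j) b) fun j _ =>
        (prod (X j₀) (Z j) c Q hc (hX.le _) (hZ.le _) (hX.inj _) (hZ.inj _)
          (hXZ _ _) (fun i hi => by
            obtain ⟨u, v, e⟩ := hQ _ hi
            exact hXY _ _ _ _ e.symm) (fun i hi => by
            obtain ⟨u, v, e⟩ := hQ _ hi
            exact hYZ _ _ _ _ e) (α * φ * a j))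
      simp only [Finset.card_univ, Fintype.card_fin] at this
      refine this.congr fun b => ?_
      simp only [digitForm, Finset.mul_sum]
      exact Finset.sum_congr rfl fun i _ => by ring)
    (h1.congr fun b => by ring)
  have h3 := hX.ph_form ha (H := fun b => φ * digitForm Y a b * digitForm Z a b)
    (N' := k * k * (2 * P + 135 * M))
    (((Indep.const _ _).mul (Digits.indep_form (fun i j => (hXY j i).symm) a j₀)).mul
      (Digits.indep_form (fun i j => (hXZ j i).symm) a j₀))
    (fun c Q hc hQ α => by
      have := Ph.sum Finset.univ (θ := fun (j : Fin k × Fin k) b =>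
          α * φ * a j.1 * a j.2 * ((c b).toNat : ℝ) * rval (Y j.1) b * rval (Z j.2) b) fun j _ =>
        (prod (Y j.1) (Z j.2) c Q hc (hY.le _) (hZ.le _) (hY.inj _) (hZ.inj _)
          (hYZ _ _) (fun i hi => by
            obtain ⟨u, v, e⟩ := hQ _ hi
            exact hXY _ _ _ _ e) (fun i hi => by
            obtain ⟨u, v, e⟩ := hQ _ hi
            exact hXZ _ _ _ _ e) (α * φ * a j.1 * a j.2))
      simp only [Finset.card_univ, Fintype.card_prod, Fintype.card_fin] at this
      refine this.congr fun b => ?_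
      rw [Fintype.sum_prod_type]
      simp only [digitForm, Finset.mul_sum, Finset.sum_mul]
      rw [Finset.sum_comm]
      exact Finset.sum_congr rfl fun i _ => Finset.sum_congr rfl fun j _ => by ring)
    (h2.congr fun b => by ring)
  refine (h3.congr fun b => by ring).mono ?_
  have e1 := Nat.mul_le_mul_right (2 * P + 135 * M + 22 * M) hK
  have e2 := Nat.mul_le_mul_right (k * (2 * P + 135 * M) + 22 * M) hK
  have e3 := Nat.mul_le_mul_right (k * k * (2 * P + 135 * M) + 22 * M) hK
  calc _ ≤ N + K * (2 * P + 135 * M + 22 * M) + K * (k * (2 * P + 135 * M) + 22 * M)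
        + K * (k * k * (2 * P + 135 * M) + 22 * M) := by omega
    _ = _ := by ring

/-! ### The Toom-Cook recursions -/

/-- The `i`-th digit, of `l` qubits, of a register; the last digits may be shorter. -/
def digitReg {ι : Type} {r : ℕ} (l : ℕ) (a : Fin r → ι) (i : ℕ) : Fin (min l (r - i * l)) → ι :=
  fun j => a ⟨i * l + j, by have := j.2; omega⟩

theorem sum_range_mul {α : Type*} [AddCommMonoid α] (F : ℕ → α) (k l : ℕ) :
    ∑ j ∈ Finset.range (k * l), F j =
      ∑ i ∈ Finset.range k, ∑ j ∈ Finset.range l, F (i * l + j) := by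
  induction k with
  | zero => simp
  | succ k ih => rw [add_mul, one_mul, Finset.sum_range_add, ih, Finset.sum_range_succ]

theorem rval_eq_sum_range {ι : Type} {r n : ℕ} (a : Fin r → ι) (b : ι → Bool) (h : r ≤ n) :
    rval a b = ∑ j ∈ Finset.range n,
      (if h : j < r then ((b (a ⟨j, h⟩)).toNat : ℝ) else 0) * 2 ^ j := by
  rw [← Finset.sum_subset (Finset.range_subset_range.2 h) fun j _ hj => by
    rw [dif_neg (by simpa using hj), zero_mul], Finset.sum_range, rval_eq]
  exact Finset.sum_congr rfl fun i _ => by rw [dif_pos i.2]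

theorem rval_eq_sum_digits {ι : Type} {r k l : ℕ} (a : Fin r → ι) (b : ι → Bool)
    (h : r ≤ k * l) :
    rval a b = ∑ i : Fin k, rval (digitReg l a i) b * (2 ^ l) ^ (i : ℕ) := by
  rw [rval_eq_sum_range a b h, sum_range_mul, Finset.sum_range]
  refine Finset.sum_congr rfl fun i _ => ?_
  rw [rval_eq_sum_range _ b (min_le_left l (r - i * l)), Finset.sum_mul]
  refine Finset.sum_congr rfl fun j hj => ?_
  have hj := Finset.mem_range.1 hj
  have : (i : ℕ) * l + j < r ↔ j < min l (r - i * l) := by omega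
  have e2 : (2 : ℝ) ^ ((i : ℕ) * l) = (2 ^ l) ^ (i : ℕ) := by rw [mul_comm, pow_mul]
  by_cases hlt : (i : ℕ) * l + j < r
  · rw [dif_pos hlt, dif_pos (this.1 hlt), digitReg, pow_add, e2]
    ring
  · rw [dif_neg hlt, dif_neg (fun h => hlt (this.2 h))]
    ring

/-- The lowest digit is the accumulator: truncation at the end of the register shortens only higher
digits, and `w ^ 0 = 1` at every evaluation point, including `w = 0`. -/
theorem digits_digitReg {r k l : ℕ} (hk : 0 < k) {a : Fin r → ι} (ha : a.Injective) :
    Digits (⟨0, hk⟩ : Fin k) (fun i : Fin k => digitReg l a i) l where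
  inj i u v e := by
    have := congrArg Fin.val (ha e)
    exact Fin.ext (by simpa using this)
  disj i j hij u v e := by
    have h1 : (i : ℕ) * l + u = j * l + v := congrArg Fin.val (ha e)
    have hu : (u : ℕ) < l := by omega
    have hv : (v : ℕ) < l := by omega
    apply hij
    ext
    have h2 := congrArg (· / l) h1
    simp only [mul_comm _ l] at h2
    rwa [Nat.mul_add_div (by omega), Nat.mul_add_div (by omega), Nat.div_eq_of_lt hu,
      Nat.div_eq_of_lt hv] at h2
  len_le i := by simp only [zero_mul, Nat.sub_zero]; omega
  len_bound := min_le_left _ _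

theorem digitReg_disj {ι : Type} {r t l l' : ℕ} {a : Fin r → ι} {c : Fin t → ι} (h : Disj a c)
    (i j : ℕ) : Disj (digitReg l a i) (digitReg l' c j) := fun _ _ => h _ _

theorem digitPoly_eval {k : ℕ} (x : Fin k → ℝ) (w : ℝ) :
    (digitPoly x).eval w = ∑ i, x i * w ^ (i : ℕ) := by
  simp [digitPoly, Polynomial.eval_finsetSum]

theorem digitPoly_natDegree_le {k : ℕ} (x : Fin k → ℝ) : (digitPoly x).natDegree ≤ k - 1 := by
  refine Polynomial.natDegree_sum_le_of_forall_le _ _ fun i _ => ?_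
  exact (Polynomial.natDegree_C_mul_X_pow_le _ _).trans (by omega)

/-- Lagrange interpolation at `0, …, q - 1`. The weights depend on `B` only, not on the polynomial,
so they can be fixed independently of the quantum state. -/
theorem exists_interpolation_weights (q : ℕ) (B : ℝ) :
    ∃ c : Fin q → ℝ, ∀ p : Polynomial ℝ, p.degree < q →
      p.eval B = ∑ i, c i * p.eval ((i : ℕ) : ℝ) := by
  refine ⟨fun i => (Lagrange.basis Finset.univ (fun i : Fin q => ((i : ℕ) : ℝ)) i).eval B,
    fun p hp => ?_⟩
  have := Lagrange.eq_interpolate (f := p) (s := (Finset.univ : Finset (Fin q)))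
    (v := fun i : Fin q => ((i : ℕ) : ℝ))
    (fun i _ j _ e => Fin.ext (Nat.cast_injective (R := ℝ) e)) (by simpa using hp)
  conv_lhs => rw [this, Lagrange.interpolate_apply, Polynomial.eval_finsetSum]
  simp [mul_comm]

theorem natAbs_pow_sum_le (k w : ℕ) (hw : w < 3 * k) :
    ∑ i : Fin k, (((w : ℤ) ^ (i : ℕ)).natAbs) ≤ k * (3 * k) ^ k := by
  refine (Finset.sum_le_card_nsmul _ _ ((3 * k) ^ k) fun i _ => ?_).trans (by simp)
  rw [Int.natAbs_pow, Int.natAbs_natCast]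
  calc w ^ (i : ℕ) ≤ (3 * k) ^ (i : ℕ) := Nat.pow_le_pow_left hw.le _
    _ ≤ _ := Nat.pow_le_pow_right (by omega) i.2.le

theorem digitForm_eq_eval {ι : Type} {k : ℕ} {len : Fin k → ℕ}
    (X : (i : Fin k) → Fin (len i) → ι) (w : ℕ) (b : ι → Bool) :
    digitForm X (fun i => (w : ℤ) ^ (i : ℕ)) b =
      (digitPoly fun i => rval (X i) b).eval (w : ℝ) := by
  rw [digitPoly_eval, digitForm]
  exact Finset.sum_congr rfl fun i _ => by push_cast; ring

theorem PPBound.mono {M P P' : ℕ} (h : PPBound M P) (hP : P ≤ P') : PPBound M P' :=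
  fun ι _ _ r t a c hr ht ha hc hac φ => (h ι r t a c hr ht ha hc hac φ).mono hP

theorem PTPBound.mono {M P P' : ℕ} (h : PTPBound M P) (hP : P ≤ P') : PTPBound M P' :=
  fun ι _ _ r s t a c e hr hs ht ha hc he hac hae hce φ =>
    (h ι r s t a c e hr hs ht ha hc he hac hae hce φ).mono hP

theorem ppBound_one : PPBound 1 1 := by
  intro ι _ _ r t a c hr ht ha hc hac φ
  rcases Nat.le_one_iff_eq_zero_or_eq_one.1 hr with rfl | rfl
  · exact (Ph.zero.mono (by omega)).congr fun b => by simp [rval, val]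
  rcases Nat.le_one_iff_eq_zero_or_eq_one.1 ht with rfl | rfl
  · exact (Ph.zero.mono (by omega)).congr fun b => by simp [rval, val]
  exact (Ph.bit2 φ (hac 0 0)).congr fun b => by simp [rval, val]

theorem ptpBound_one : PTPBound 1 1 := by
  intro ι _ _ r s t a c e hr hs ht ha hc he hac hae hce φ
  rcases Nat.le_one_iff_eq_zero_or_eq_one.1 hr with rfl | rfl
  · exact (Ph.zero.mono (by omega)).congr fun b => by simp [rval, val]
  rcases Nat.le_one_iff_eq_zero_or_eq_one.1 hs with rfl | rfl
  · exact (Ph.zero.mono (by omega)).congr fun b => by simp [rval, val]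
  rcases Nat.le_one_iff_eq_zero_or_eq_one.1 ht with rfl | rfl
  · exact (Ph.zero.mono (by omega)).congr fun b => by simp [rval, val]
  exact (Ph.bit3 φ (hac 0 0) (hae 0 0) (hce 0 0)).congr fun b => by simp [rval, val]

/-- Two digit polynomials multiply to degree at most `2k - 2`, hence `2k - 1` points. The weight of
a point multiplies the angle; this is harmless because `PPBound` covers all real angles. -/
theorem PPBound.toomCook {k l P : ℕ} (hk : 2 ≤ k) (h : PPBound l P) :
    PPBound (k * l) ((2 * k - 1) * (P + k * (3 * k) ^ k * (81 * (k + 1) + 44) * l)) := by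
  intro ι _ _ r t a c hr ht ha hc hac φ
  obtain ⟨wt, hwt⟩ := exists_interpolation_weights (2 * k - 1) (2 ^ l)
  have hX := digits_digitReg (l := l) (show 0 < k by omega) ha
  have hZ := digits_digitReg (l := l) (show 0 < k by omega) hc
  have key := Ph.sum Finset.univ fun (w : Fin (2 * k - 1)) _ =>
    ph_form_mul_form hX hZ (fun i j => digitReg_disj hac i j)
      (a := fun i : Fin k => ((w : ℕ) : ℤ) ^ (i : ℕ)) (pow_zero _)
      (natAbs_pow_sum_le k w (by omega)) (φ := φ * wt w)
      (h ι _ _ _ _ (hX.le _) (hZ.le _) (hX.inj _) (hZ.inj _) (digitReg_disj hac _ _) _)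
  rw [Finset.card_univ, Fintype.card_fin] at key
  refine (key.congr fun b => ?_).mono (Nat.mul_le_mul_left _ (le_of_eq (by ring)))
  set px := digitPoly fun i : Fin k => rval (digitReg l a i) b with hpx
  set pz := digitPoly fun i : Fin k => rval (digitReg l c i) b with hpz
  have hdeg : (px * pz).degree < ((2 * k - 1 : ℕ) : WithBot ℕ) := by
    refine Polynomial.degree_le_natDegree.trans_lt (Nat.cast_lt.2 ?_)
    have h1 : px.natDegree ≤ k - 1 := digitPoly_natDegree_le _
    have h2 : pz.natDegree ≤ k - 1 := digitPoly_natDegree_le _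
    have := Polynomial.natDegree_mul_le (p := px) (q := pz)
    omega
  have e := hwt (px * pz) hdeg
  have ea : rval a b = px.eval (2 ^ l) := by
    rw [hpx, digitPoly_eval, rval_eq_sum_digits a b hr]
  have ec : rval c b = pz.eval (2 ^ l) := by
    rw [hpz, digitPoly_eval, rval_eq_sum_digits c b ht]
  rw [ea, ec, mul_assoc, ← Polynomial.eval_mul, e, Finset.mul_sum]
  refine Finset.sum_congr rfl fun w _ => ?_
  rw [digitForm_eq_eval, digitForm_eq_eval, Polynomial.eval_mul]
  ring

/-- The three-factor analogue, with `3k - 2` points. Only one smaller triple product is used per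
point; everything else is charged to the two-factor bound. -/
theorem PTPBound.toomCook {k l P P₂ : ℕ} (hk : 2 ≤ k) (h : PTPBound l P) (h₂ : PPBound l P₂) :
    PTPBound (k * l) ((3 * k - 2) *
      (P + k * (3 * k) ^ k * ((k * k + k + 1) * (2 * P₂ + 135 * l) + 66 * l))) := by
  intro ι _ _ r s t a c d hr hs ht ha hc hd hac had hcd φ
  obtain ⟨wt, hwt⟩ := exists_interpolation_weights (3 * k - 2) (2 ^ l)
  have hX := digits_digitReg (l := l) (show 0 < k by omega) ha
  have hY := digits_digitReg (l := l) (show 0 < k by omega) hc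
  have hZ := digits_digitReg (l := l) (show 0 < k by omega) hd
  have key := Ph.sum Finset.univ fun (w : Fin (3 * k - 2)) _ =>
    ph_form_mul_form_mul_form hX hY hZ (fun i j => digitReg_disj hac i j)
      (fun i j => digitReg_disj had i j) (fun i j => digitReg_disj hcd i j)
      (a := fun i : Fin k => ((w : ℕ) : ℤ) ^ (i : ℕ)) (pow_zero _)
      (natAbs_pow_sum_le k w (by omega)) h₂ (φ := φ * wt w)
      (h ι _ _ _ _ _ _ (hX.le _) (hY.le _) (hZ.le _) (hX.inj _) (hY.inj _) (hZ.inj _)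
        (digitReg_disj hac _ _) (digitReg_disj had _ _) (digitReg_disj hcd _ _) _)
  rw [Finset.card_univ, Fintype.card_fin] at key
  refine key.congr fun b => ?_
  set px := digitPoly fun i : Fin k => rval (digitReg l a i) b with hpx
  set py := digitPoly fun i : Fin k => rval (digitReg l c i) b with hpy
  set pz := digitPoly fun i : Fin k => rval (digitReg l d i) b with hpz
  have hdeg : (px * py * pz).degree < ((3 * k - 2 : ℕ) : WithBot ℕ) := by
    refine Polynomial.degree_le_natDegree.trans_lt (Nat.cast_lt.2 ?_)
    have h1 : px.natDegree ≤ k - 1 := digitPoly_natDegree_le _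
    have h2 : py.natDegree ≤ k - 1 := digitPoly_natDegree_le _
    have h3 : pz.natDegree ≤ k - 1 := digitPoly_natDegree_le _
    have h4 := Polynomial.natDegree_mul_le (p := px) (q := py)
    have h5 := Polynomial.natDegree_mul_le (p := px * py) (q := pz)
    omega
  have e := hwt (px * py * pz) hdeg
  have ea : rval a b = px.eval (2 ^ l) := by
    rw [hpx, digitPoly_eval, rval_eq_sum_digits a b hr]
  have ec : rval c b = py.eval (2 ^ l) := by
    rw [hpy, digitPoly_eval, rval_eq_sum_digits c b hs]
  have ed : rval d b = pz.eval (2 ^ l) := by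
    rw [hpz, digitPoly_eval, rval_eq_sum_digits d b ht]
  rw [ea, ec, ed, mul_assoc, mul_assoc, ← mul_assoc (px.eval _), ← Polynomial.eval_mul,
    ← Polynomial.eval_mul, e, Finset.mul_sum]
  refine Finset.sum_congr rfl fun w _ => ?_
  rw [digitForm_eq_eval, digitForm_eq_eval, digitForm_eq_eval, Polynomial.eval_mul,
    Polynomial.eval_mul]
  ring

/-- The recursion `T (d + 1) = p (T d + C m ^ d)` with `m < p` gives `T d = O (p ^ d)`. -/
theorem bound_of_recursion {p m C : ℕ} (hmp : m < p) {Q : ℕ → ℕ → Prop} (h0 : Q 0 1)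
    (hs : ∀ d P, Q d P → Q (d + 1) (p * (P + C * m ^ d))) (d : ℕ) :
    ∃ P, Q d P ∧ P ≤ (1 + p * C) * p ^ d := by
  -- The added lower-order term makes the induction close: `(m + 1) * (p * C * m ^ d) ≤ p * (p * C *
  -- m ^ d)` absorbs both the new cost and the next extra term.
  suffices ∃ P, Q d P ∧ P + p * C * m ^ d ≤ (1 + p * C) * p ^ d by
    obtain ⟨P, h, hP⟩ := this
    exact ⟨P, h, (Nat.le_add_right _ _).trans hP⟩
  induction d with
  | zero => exact ⟨1, h0, by simp⟩
  | succ d ih =>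
    obtain ⟨P, h, hP⟩ := ih
    refine ⟨_, hs d P h, ?_⟩
    have e1 := Nat.mul_le_mul_left p hP
    have e2 : (m + 1) * (p * C * m ^ d) ≤ p * (p * C * m ^ d) := Nat.mul_le_mul_right _ hmp
    rw [pow_succ, pow_succ]
    nlinarith

theorem exists_ppBound {k : ℕ} (hk : 2 ≤ k) :
    ∃ A : ℕ, ∀ d, PPBound (k ^ d) (A * (2 * k - 1) ^ d) := by
  choose P h hP using bound_of_recursion (p := 2 * k - 1) (m := k)
      (C := k * (3 * k) ^ k * (81 * (k + 1) + 44)) (by omega)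
      (Q := fun d P => PPBound (k ^ d) P) (by simpa using ppBound_one)
      (fun d P h => by
        rw [pow_succ, mul_comm (k ^ d)]
        exact h.toomCook hk)
  exact ⟨_, fun d => (h d).mono (hP d)⟩

theorem exists_ptpBound {k : ℕ} (hk : 2 ≤ k) :
    ∃ A : ℕ, ∀ d, PTPBound (k ^ d) (A * (3 * k - 2) ^ d) := by
  obtain ⟨A, hA⟩ := exists_ppBound hk
  -- The overhead grows like `(2k - 1) ^ d`, and `2k - 1 < 3k - 2` exactly because `k ≥ 2`.
  choose P h hP using bound_of_recursion (p := 3 * k - 2) (m := 2 * k - 1)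
      (C := k * (3 * k) ^ k * ((k * k + k + 1) * (2 * A + 135) + 66)) (by omega)
      (Q := fun d P => PTPBound (k ^ d) P) (by simpa using ptpBound_one)
      (fun d P h => by
        rw [pow_succ, mul_comm (k ^ d)]
        refine (h.toomCook hk (hA d)).mono (Nat.mul_le_mul_left _ (Nat.add_le_add_left ?_ _))
        have : k ^ d ≤ (2 * k - 1) ^ d := Nat.pow_le_pow_left (by omega) d
        calc _ ≤ k * (3 * k) ^ k * ((k * k + k + 1) * (2 * (A * (2 * k - 1) ^ d) +
              135 * (2 * k - 1) ^ d) + 66 * (2 * k - 1) ^ d) := by gcongr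
          _ = _ := by ring)
  exact ⟨_, fun d => (h d).mono (hP d)⟩

/-! ### The Fourier transform from two-factor phases -/

/-- The value of a register, its qubits being read in reverse order. -/
def revVal {ι : Type} {t : ℕ} (a : Fin t → ι) (b : ι → Bool) : ℝ := rval (fun i => a i.rev) b

theorem revVal_eq {ι : Type} {t : ℕ} (a : Fin t → ι) (b : ι → Bool) :
    revVal a b = ∑ i, ((b (a i)).toNat : ℝ) * 2 ^ (i.rev : ℕ) := by
  rw [revVal, rval_eq]
  exact Fintype.sum_equiv Fin.revPerm _ _ fun i => by simp

theorem rval_append {ι : Type} {t₁ t₂ : ℕ} (a : Fin (t₁ + t₂) → ι) (b : ι → Bool) :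
    rval a b = rval (fun i => a (Fin.castAdd t₂ i)) b +
      2 ^ t₁ * rval (fun i => a (Fin.natAdd t₁ i)) b := by
  rw [rval_eq, rval_eq, rval_eq, Fin.sum_univ_add, Finset.mul_sum]
  congr 1
  refine Finset.sum_congr rfl fun i _ => ?_
  rw [Fin.val_natAdd, pow_add]
  ring

theorem revVal_append {ι : Type} {t₁ t₂ : ℕ} (a : Fin (t₁ + t₂) → ι) (b : ι → Bool) :
    revVal a b = 2 ^ t₂ * revVal (fun i => a (Fin.castAdd t₂ i)) b +
      revVal (fun i => a (Fin.natAdd t₁ i)) b := by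
  rw [revVal_eq, revVal_eq, revVal_eq, Fin.sum_univ_add, Finset.mul_sum]
  congr 1
  · refine Finset.sum_congr rfl fun i _ => ?_
    rw [show ((Fin.castAdd t₂ i).rev : ℕ) = t₂ + i.rev by
      simp only [Fin.val_rev, Fin.val_castAdd]; omega, pow_add]
    ring
  · refine Finset.sum_congr rfl fun i _ => ?_
    rw [show ((Fin.natAdd t₁ i).rev : ℕ) = i.rev by
      simp only [Fin.val_rev, Fin.val_natAdd]; omega]

/-- `b` and `b'` agree on the qubits outside the register `a`. -/
def AgreeOff {ι : Type} {t : ℕ} (a : Fin t → ι) (b' b : ι → Bool) : Prop :=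
  ∀ q, (∀ i, q ≠ a i) → b' q = b q

open Classical in
/-- The quantum Fourier transform of a register, with the bits of the output reversed. -/
noncomputable def qft {t : ℕ} (a : Fin t → ι) : Op ι :=
  Matrix.of fun b' b => if AgreeOff a b' b then
    Complex.exp (Complex.I * ((2 * Real.pi * rval a b * revVal a b' / 2 ^ t : ℝ) : ℂ)) /
      (Real.sqrt 2 : ℂ) ^ t else 0

theorem qft_zero (a : Fin 0 → ι) : qft a = 1 := by
  ext b' b
  have : AgreeOff a b' b ↔ b' = b :=
    ⟨fun h => funext fun q => h q fun i => i.elim0, fun h q _ => by rw [h]⟩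
  simp [qft, this, rval, revVal, val, Matrix.one_apply]

theorem qft_one (a : Fin 1 → ι) : qft a = (Gate.H (a 0)).op := by
  ext b' b
  have : AgreeOff a b' b ↔ b' = Function.update b (a 0) (b' (a 0)) := by
    constructor
    · intro h
      funext q
      by_cases hq : q = a 0
      · subst hq; simp
      · rw [Function.update_of_ne hq]
        exact h q fun i => by rwa [Subsingleton.elim i 0]
    · intro h q hq
      rw [h, Function.update_of_ne (hq 0)]
  simp only [qft, Gate.op, Matrix.of_apply, pow_one]
  by_cases h : AgreeOff a b' b
  · rw [if_pos h, if_pos (this.1 h)]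
    congr 1
    have h1 : rval a b = ((b (a 0)).toNat : ℝ) := by simp [rval_eq]
    have h2 : revVal a b' = ((b' (a 0)).toNat : ℝ) := by simp [revVal_eq]
    rw [h1, h2]
    cases b (a 0) <;> cases b' (a 0) <;> simp
    rw [mul_comm, Complex.exp_pi_mul_I]
  · rw [if_neg h, if_neg (fun h' => h (this.2 h'))]

/-- Write the input as `L + 2 ^ t₁ * H` and the reversed output as `2 ^ t₂ * U + R`. Divided by `2 ^
(t₁ + t₂)`, their product contains the exponents of the two smaller transforms, the cross term `L
R`, which is a two-factor phase, and the integer `H U`, which is invisible. -/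
theorem qft_append {t₁ t₂ : ℕ} (a : Fin (t₁ + t₂) → ι) (ha : a.Injective) :
    qft a = qft (fun i => a (Fin.castAdd t₂ i)) *
      (phaseOp (fun b => 2 * Real.pi / 2 ^ (t₁ + t₂) * rval (fun i => a (Fin.castAdd t₂ i)) b *
        rval (fun i => a (Fin.natAdd t₁ i.rev)) b) * qft fun i => a (Fin.natAdd t₁ i)) := by
  set lo : Fin t₁ → ι := fun i => a (Fin.castAdd t₂ i) with hlo
  set hi : Fin t₂ → ι := fun i => a (Fin.natAdd t₁ i) with hhi
  have hloinj : lo.Injective := ha.comp (Fin.castAdd_injective _ _)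
  have hd : Disj lo hi := fun i j e => by
    have := congrArg Fin.val (ha e)
    simp at this
    omega
  have hoff : ∀ q, (∀ i, q ≠ a i) ↔ (∀ i, q ≠ lo i) ∧ ∀ i, q ≠ hi i := fun q => by
    constructor
    · exact fun h => ⟨fun i => h _, fun i => h _⟩
    · rintro ⟨h1, h2⟩ i
      induction i using Fin.addCases with
      | left i => exact h1 i
      | right i => exact h2 i
  ext b' b
  rw [Matrix.mul_apply]
  simp only [phaseOp, Matrix.diagonal_mul, qft, Matrix.of_apply]
  -- The only intermediate state that contributes: the high part is already transformed and the low
  -- part is still the input.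
  set b₀ : ι → Bool := Function.extend lo (fun i => b (lo i)) b' with hb₀
  have b₀lo : ∀ i, b₀ (lo i) = b (lo i) := fun i => hloinj.extend_apply _ _ _
  have b₀off : ∀ q, (∀ i, q ≠ lo i) → b₀ q = b' q := fun q hq =>
    Function.extend_apply' _ _ _ fun ⟨i, e⟩ => hq i e.symm
  have huniq : ∀ c, AgreeOff lo b' c → AgreeOff hi c b → c = b₀ := fun c h1 h2 => by
    funext q
    by_cases hq : ∀ i, q ≠ lo i
    · rw [b₀off q hq, h1 q hq]
    · push Not at hq
      obtain ⟨i, rfl⟩ := hq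
      rw [b₀lo, h2 _ fun j => hd i j]
  rw [Finset.sum_eq_single b₀ (fun c _ hc => by
    by_cases h1 : AgreeOff lo b' c
    · rw [if_neg (fun h2 => hc (huniq c h1 h2)), mul_zero, mul_zero]
    · rw [if_neg h1, zero_mul]) (by simp)]
  rw [if_pos (show AgreeOff lo b' b₀ from fun q hq => (b₀off q hq).symm)]
  by_cases h : AgreeOff a b' b
  · have h2 : AgreeOff hi b₀ b := fun q hq => by
      by_cases hq' : ∀ i, q ≠ lo i
      · rw [b₀off q hq']
        exact h q ((hoff q).2 ⟨hq', hq⟩)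
      · push Not at hq'
        obtain ⟨i, rfl⟩ := hq'
        rw [b₀lo]
    rw [if_pos h, if_pos h2]
    have e1 : rval lo b₀ = rval lo b := rval_congr b₀lo
    have e2 : revVal hi b₀ = revVal hi b' :=
      rval_congr fun i => b₀off _ fun j e => hd j _ e.symm
    have e3 : rval (fun i => a (Fin.natAdd t₁ i.rev)) b₀ = revVal hi b' := e2
    rw [e1, e2, e3, rval_append a b, revVal_append a b']
    change Complex.exp (Complex.I * ((2 * Real.pi * (rval lo b + 2 ^ t₁ * rval hi b) *
      (2 ^ t₂ * revVal lo b' + revVal hi b') / 2 ^ (t₁ + t₂) : ℝ) : ℂ)) / _ = _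
    set L := rval lo b
    set R := revVal hi b'
    have hint : Complex.exp (Complex.I * ((2 * Real.pi * (rval hi b * revVal lo b') : ℝ) : ℂ))
        = 1 := by
      rw [Complex.exp_eq_one_iff]
      refine ⟨(val fun i => b (hi i)) * (val fun i => b' (lo i.rev)), ?_⟩
      simp only [rval, revVal]
      push_cast
      ring
    have hsplit : (2 * Real.pi * (L + 2 ^ t₁ * rval hi b) * (2 ^ t₂ * revVal lo b' + R) /
        2 ^ (t₁ + t₂) : ℝ) = 2 * Real.pi * L * revVal lo b' / 2 ^ t₁ +
        2 * Real.pi / 2 ^ (t₁ + t₂) * L * R + 2 * Real.pi * rval hi b * R / 2 ^ t₂ +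
        2 * Real.pi * (rval hi b * revVal lo b') := by
      rw [pow_add]
      field_simp
      ring
    rw [hsplit, Complex.ofReal_add, Complex.ofReal_add, Complex.ofReal_add, mul_add, mul_add,
      mul_add, Complex.exp_add, Complex.exp_add, Complex.exp_add, hint]
    field_simp
    rw [pow_add]
  · rw [if_neg h, if_neg, mul_zero, mul_zero]
    intro h2
    apply h
    intro q hq
    obtain ⟨h3, h4⟩ := (hoff q).1 hq
    rw [← b₀off q h3, h2 q h4]

/-- Fourier transforms of registers of at most `M` qubits need at most `N` gates. -/
def QFTBound (M N : ℕ) : Prop :=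
  ∀ (ι : Type) [Fintype ι] [DecidableEq ι] (t : ℕ) (a : Fin t → ι), t ≤ M → a.Injective →
    Impl (qft a) N

theorem QFTBound.mono {M N N' : ℕ} (h : QFTBound M N) (hN : N ≤ N') : QFTBound M N' :=
  fun ι _ _ t a ht ha => (h ι t a ht ha).mono hN

theorem qftBound_one : QFTBound 1 1 := by
  intro ι _ _ t a ht ha
  rcases Nat.le_one_iff_eq_zero_or_eq_one.1 ht with rfl | rfl
  · rw [qft_zero]; exact Impl.one.mono (by omega)
  · rw [qft_one]; exact Impl.gate _

theorem QFTBound.blocks {M N P k : ℕ} (h : QFTBound M N) (hP : PPBound (k * M) P) (j : ℕ)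
    (hj : j ≤ k) : QFTBound (j * M) (j * (N + P)) := by
  induction j with
  | zero =>
    intro ι _ _ t a ht ha
    obtain rfl : t = 0 := by omega
    rw [qft_zero]; exact Impl.one.mono (by omega)
  | succ j ih =>
    intro ι _ _ t a ht ha
    rw [add_mul, one_mul] at ht
    have hjk : j * M + M ≤ k * M := by
      have := Nat.mul_le_mul_right M hj
      rwa [add_mul, one_mul] at this
    obtain ⟨t₁, t₂, rfl, h1, h2⟩ : ∃ t₁ t₂, t = t₁ + t₂ ∧ t₁ ≤ j * M ∧ t₂ ≤ M :=
      ⟨min t (j * M), t - min t (j * M), by omega, by omega, by omega⟩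
    -- Peel off the top block; a register that fits into `j` blocks leaves an empty one.
    rw [qft_append a ha]
    have hlo : Function.Injective fun i : Fin t₁ => a (Fin.castAdd t₂ i) :=
      ha.comp (Fin.castAdd_injective _ _)
    have hhi : Function.Injective fun i : Fin t₂ => a (Fin.natAdd t₁ i) :=
      ha.comp (Fin.natAdd_injective _ _)
    have hpp := hP ι t₁ t₂ (fun i => a (Fin.castAdd t₂ i)) (fun i => a (Fin.natAdd t₁ i.rev))
      (by omega) (by omega) hlo (hhi.comp Fin.rev_injective) (fun i j e => by
        have := congrArg Fin.val (ha e)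
        simp at this
        omega) (2 * Real.pi / 2 ^ (t₁ + t₂))
    refine ((ih (by omega) ι t₁ _ h1 hlo).mul (hpp.mul (h ι t₂ _ h2 hhi))).mono ?_
    rw [add_mul j 1, one_mul]
    omega

theorem exists_qftBound {k : ℕ} (hk : 2 ≤ k) :
    ∃ A : ℕ, ∀ d, QFTBound (k ^ d) (A * (2 * k - 1) ^ d) := by
  obtain ⟨A, hA⟩ := exists_ppBound hk
  -- With `p = 2k - 1`, this constant closes the induction because `3k ≤ 2p` and `k ≤ p`.
  refine ⟨2 * A * (2 * k - 1) + 1, fun d => ?_⟩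
  induction d with
  | zero => exact (pow_zero k).symm ▸ qftBound_one.mono (by simp)
  | succ d ih =>
    have hpp := hA (d + 1)
    rw [pow_succ, mul_comm (k ^ d)] at hpp ⊢
    refine (ih.blocks hpp k le_rfl).mono ?_
    obtain ⟨m, rfl⟩ : ∃ m, k = m + 2 := ⟨k - 2, by omega⟩
    rw [show 2 * (m + 2) - 1 = 2 * m + 3 by omega, pow_succ]
    have : 0 < (2 * m + 3) ^ d := by positivity
    generalize (2 * m + 3) ^ d = x at *
    nlinarith [Nat.zero_le (A * m * x), Nat.zero_le (A * m * m * x), Nat.zero_le (m * x)]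

/-! ### Geometric sums and the measurement bound -/

/-- The bits of a number. -/
def bitsEquiv (t : ℕ) : (Fin t → Bool) ≃ Fin (2 ^ t) :=
  (Equiv.arrowCongr (Equiv.refl _) finTwoEquiv.symm).trans finFunctionFinEquiv

theorem bitsEquiv_val {t : ℕ} (s : Fin t → Bool) : (bitsEquiv t s : ℕ) = val s := by
  rw [bitsEquiv, Equiv.trans_apply, finFunctionFinEquiv_apply, val]
  refine Finset.sum_congr rfl fun i _ => ?_
  congr 1
  change ((finTwoEquiv.symm (s i) : Fin 2) : ℕ) = _
  cases s i <;> rfl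

theorem val_injective (t : ℕ) : Function.Injective (val : (Fin t → Bool) → ℕ) := fun s s' h =>
  (bitsEquiv t).injective (Fin.ext (by rwa [bitsEquiv_val, bitsEquiv_val]))

theorem val_lt {t : ℕ} (s : Fin t → Bool) : val s < 2 ^ t := by
  rw [← bitsEquiv_val]; exact (bitsEquiv t s).2

theorem sum_val {t : ℕ} {α : Type*} [AddCommMonoid α] (F : ℕ → α) :
    ∑ s : Fin t → Bool, F (val s) = ∑ j ∈ Finset.range (2 ^ t), F j := by
  rw [Finset.sum_range]
  exact Fintype.sum_equiv (bitsEquiv t) _ _ fun s => by rw [bitsEquiv_val]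

/-- The average of the powers of `exp (2 π i δ / M)`. -/
noncomputable def fourierMean (M : ℕ) (δ : ℝ) : ℂ :=
  (∑ j ∈ Finset.range M, Complex.exp (Complex.I * ((2 * Real.pi / M * δ : ℝ) : ℂ)) ^ j) / M

theorem exp_fourier_eq_one_iff {M : ℕ} (hM : 0 < M) (δ : ℝ) :
    Complex.exp (Complex.I * ((2 * Real.pi / M * δ : ℝ) : ℂ)) = 1 ↔ ∃ m : ℤ, δ = M * m := by
  have hM' : (M : ℝ) ≠ 0 := by positivity
  have hpi := Real.pi_ne_zero
  rw [Complex.exp_eq_one_iff]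
  refine exists_congr fun m => ?_
  rw [show (m : ℂ) * (2 * Real.pi * Complex.I) = Complex.I * ((2 * Real.pi * m : ℝ) : ℂ) by
    push_cast; ring, mul_right_inj' Complex.I_ne_zero, Complex.ofReal_inj]
  constructor
  · intro h
    field_simp at h
    linarith
  · intro h
    rw [h]
    field_simp

theorem exp_fourier_pow {M : ℕ} (hM : 0 < M) (δ : ℝ) :
    Complex.exp (Complex.I * ((2 * Real.pi / M * δ : ℝ) : ℂ)) ^ M =
      Complex.exp (Complex.I * ((2 * Real.pi * δ : ℝ) : ℂ)) := by
  have hM' : (M : ℂ) ≠ 0 := by exact_mod_cast hM.ne'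
  rw [← Complex.exp_nat_mul]
  congr 1
  push_cast
  field_simp

theorem fourierMean_int {M : ℕ} (hM : 0 < M) (z : ℤ) [Decidable ((M : ℤ) ∣ z)] :
    fourierMean M z = if (M : ℤ) ∣ z then 1 else 0 := by
  have hM' : (M : ℂ) ≠ 0 := by exact_mod_cast hM.ne'
  have hiff := exp_fourier_eq_one_iff hM (z : ℝ)
  split_ifs with h
  · obtain ⟨m, rfl⟩ := h
    rw [fourierMean, hiff.2 ⟨m, by push_cast; ring⟩]
    simp [hM']
  · have hne : Complex.exp (Complex.I * ((2 * Real.pi / M * z : ℝ) : ℂ)) ≠ 1 := fun e => by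
      obtain ⟨m, hm⟩ := hiff.1 e
      exact h ⟨m, by exact_mod_cast hm⟩
    rw [fourierMean, geom_sum_eq hne, exp_fourier_pow hM,
      show Complex.exp (Complex.I * ((2 * Real.pi * z : ℝ) : ℂ)) = 1 by
        rw [Complex.exp_eq_one_iff]; exact ⟨z, by push_cast; ring⟩]
    simp

/-- For a geometric sum with ratio `z` of modulus one, `|z ^ M - 1| ≤ 2`. Jordan's inequality for
the sine gives `|z - 1| ≥ 4 |d| / M`, where `d` is the offset from the multiple `M * m`, at most `M
/ 2` in size. -/
theorem norm_fourierMean_le {M : ℕ} (hM : 0 < M) (δ : ℝ) (m : ℤ) (hd : |δ - M * m| ≤ M / 2) :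
    ‖fourierMean M δ‖ * (2 * |δ - M * m|) ≤ 1 := by
  have hM' : (0 : ℝ) < M := by exact_mod_cast hM
  have hpi := Real.pi_pos
  set d := δ - M * m with hdef
  have hz : Complex.exp (Complex.I * ((2 * Real.pi / M * δ : ℝ) : ℂ)) =
      Complex.exp (Complex.I * ((2 * Real.pi / M * d : ℝ) : ℂ)) := by
    rw [show (2 * Real.pi / M * δ : ℝ) = 2 * Real.pi / M * d + 2 * Real.pi / M * (M * m) by
      rw [hdef]; ring, Complex.ofReal_add, mul_add, Complex.exp_add,
      (exp_fourier_eq_one_iff hM _).2 ⟨m, rfl⟩, mul_one]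
  set z := Complex.exp (Complex.I * ((2 * Real.pi / M * δ : ℝ) : ℂ)) with hzdef
  have h1 : 4 * |d| / M ≤ ‖z - 1‖ := by
    rw [hz, Complex.norm_exp_I_mul_ofReal_sub_one, Real.norm_eq_abs, abs_mul, abs_two]
    have h2 : |2 * Real.pi / M * d / 2| = Real.pi * |d| / M := by
      rw [show 2 * Real.pi / M * d / 2 = Real.pi / M * d by ring, abs_mul,
        abs_of_pos (by positivity)]
      ring
    have h3 : Real.pi * |d| / M ≤ Real.pi / 2 := by
      rw [div_le_iff₀ hM']
      nlinarith
    have := Real.mul_abs_le_abs_sin (x := 2 * Real.pi / M * d / 2) (by rw [h2]; exact h3)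
    rw [h2] at this
    calc 4 * |d| / M = 2 * (2 / Real.pi * (Real.pi * |d| / M)) := by field_simp; ring
      _ ≤ _ := by linarith
  have h2 : ‖(∑ j ∈ Finset.range M, z ^ j)‖ * ‖z - 1‖ ≤ 2 := by
    rw [← norm_mul, geom_sum_mul]
    refine (norm_sub_le _ _).trans ?_
    rw [norm_pow, hzdef, mul_comm, Complex.norm_exp_ofReal_mul_I]
    norm_num
  rw [fourierMean, norm_div, Complex.norm_natCast]
  have h3 := mul_le_mul_of_nonneg_left h1 (norm_nonneg (∑ j ∈ Finset.range M, z ^ j))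
  have h4 := h3.trans h2
  calc _ = ‖∑ j ∈ Finset.range M, z ^ j‖ * (4 * |d| / M) / 2 := by ring
    _ ≤ _ := by linarith

theorem sum_range_inv_sq_le {e : ℝ} (he : 1 < e) (n : ℕ) :
    ∑ i ∈ Finset.range n, 1 / (e + i) ^ 2 ≤ 1 / (e - 1) - 1 / (e + n - 1) := by
  induction n with
  | zero => simp
  | succ n ih =>
    rw [Finset.sum_range_succ]
    have hn : (0 : ℝ) ≤ n := Nat.cast_nonneg n
    have : 1 / (e + n) ^ 2 ≤ 1 / (e + n - 1) - 1 / (e + (n + 1 : ℕ) - 1) := by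
      push_cast
      rw [show e + ((n : ℝ) + 1) - 1 = e + n by ring, div_sub_div _ _ (by linarith) (by linarith),
        div_le_div_iff₀ (by nlinarith) (by nlinarith)]
      nlinarith
    linarith

/-- Distinct reals with integral differences have distinct integer parts after subtracting `e`, so
the sum is dominated by that of `1 / (e + i) ^ 2`, which telescopes. -/
theorem sum_inv_sq_le {α : Type*} (S : Finset α) (r : α → ℝ) {e : ℝ} (he : 1 < e)
    (hr : ∀ w ∈ S, e < r w) (hinj : Set.InjOn r S)
    (hint : ∀ w ∈ S, ∀ w' ∈ S, ∃ m : ℤ, r w - r w' = m) :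
    ∑ w ∈ S, 1 / (r w) ^ 2 ≤ 1 / (e - 1) := by
  classical
  have hf : ∀ w ∈ S, e + (⌊r w - e⌋₊ : ℕ) ≤ r w := fun w hw => by
    have := Nat.floor_le (a := r w - e) (by linarith [hr w hw])
    linarith
  have hfi : Set.InjOn (fun w => ⌊r w - e⌋₊) S := fun w hw w' hw' h => by
    apply hinj hw hw'
    simp only at h
    have h1 := hf w hw
    have h2 := hf w' hw'
    have h3 := Nat.lt_floor_add_one (r w - e)
    have h4 := Nat.lt_floor_add_one (r w' - e)
    rw [h] at h1 h3
    obtain ⟨m, hm⟩ := hint w hw w' hw'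
    have h5 : m < 1 := by exact_mod_cast (show (m : ℝ) < 1 by linarith)
    have h6 : -1 < m := by exact_mod_cast (show (-1 : ℝ) < m by linarith)
    obtain rfl : m = 0 := by omega
    simp at hm
    linarith
  calc ∑ w ∈ S, 1 / (r w) ^ 2 ≤ ∑ w ∈ S, 1 / (e + (⌊r w - e⌋₊ : ℕ)) ^ 2 := by
        refine Finset.sum_le_sum fun w hw => ?_
        have := hf w hw
        have h0 : (0 : ℝ) ≤ (⌊r w - e⌋₊ : ℕ) := Nat.cast_nonneg _
        gcongr
    _ = ∑ i ∈ S.image fun w => ⌊r w - e⌋₊, 1 / (e + (i : ℕ)) ^ 2 :=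
        (Finset.sum_image (f := fun i : ℕ => 1 / (e + (i : ℝ)) ^ 2) hfi).symm
    _ ≤ ∑ i ∈ Finset.range ((S.image fun w => ⌊r w - e⌋₊).sup id + 1), 1 / (e + (i : ℕ)) ^ 2 := by
        refine Finset.sum_le_sum_of_subset_of_nonneg (fun i hi => ?_) fun i _ _ => by positivity
        exact Finset.mem_range.2 (Nat.lt_succ_of_le (Finset.le_sup (f := id) hi))
    _ ≤ 1 / (e - 1) := by
        refine (sum_range_inv_sq_le he _).trans (sub_le_self _ ?_)
        refine div_nonneg zero_le_one ?_
        have := Nat.cast_nonneg (α := ℝ) ((S.image fun w => ⌊r w - e⌋₊).sup id + 1)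
        linarith

/-- The measurement statistics of phase estimation. -/
theorem sum_norm_fourierMean_le {M : ℕ} (hM : 0 < M) (μ : ℝ) {e : ℝ} (he : 1 < e) :
    ∑ w ∈ Finset.range M with e < circDist M ((w : ℕ) - μ), ‖fourierMean M (μ - (w : ℕ))‖ ^ 2 ≤
      1 / (2 * (e - 1)) := by
  classical
  have hM' : (0 : ℝ) < M := by exact_mod_cast hM
  set r : ℕ → ℝ := fun w => ((w : ℝ) - μ) - M * round (((w : ℝ) - μ) / M) with hr
  have hcd : ∀ w : ℕ, circDist M ((w : ℕ) - μ) = |r w| := fun w => rfl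
  have hle : ∀ w : ℕ, |r w| ≤ M / 2 := fun w => by
    have := abs_sub_round (((w : ℝ) - μ) / M)
    have h2 : r w = M * (((w : ℝ) - μ) / M - round (((w : ℝ) - μ) / M)) := by
      simp only [hr]; field_simp
    rw [h2, abs_mul, abs_of_pos hM']
    nlinarith
  have hbd : ∀ w : ℕ, e < |r w| → ‖fourierMean M (μ - (w : ℕ))‖ ^ 2 ≤ 1 / 4 * (1 / (r w) ^ 2) :=
      fun w hw => by
    have e1 : |μ - w - M * (-(round (((w : ℝ) - μ) / M)) : ℤ)| = |r w| := by
      rw [← abs_neg]; congr 1; push_cast; simp only [hr]; ring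
    have h1 := norm_fourierMean_le hM (μ - w) (-(round (((w : ℝ) - μ) / M))) (by
      rw [e1]; exact hle w)
    rw [e1] at h1
    have hpos : 0 < |r w| := by linarith
    have h2 : ‖fourierMean M (μ - w)‖ ≤ 1 / (2 * |r w|) := by
      rw [le_div_iff₀ (by linarith)]; exact h1
    calc _ ≤ (1 / (2 * |r w|)) ^ 2 := by gcongr
      _ = _ := by rw [div_pow, mul_pow, sq_abs]; field_simp; norm_num
  have hint : ∀ w w' : ℕ, ∃ m : ℤ, r w - r w' = m := fun w w' =>
    ⟨(w : ℤ) - w' - M * round (((w : ℝ) - μ) / M) + M * round (((w' : ℝ) - μ) / M), by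
      simp only [hr]; push_cast; ring⟩
  have hinj : Set.InjOn r (Finset.range M) := fun w hw w' hw' h => by
    have hw := Finset.mem_range.1 hw
    have hw' := Finset.mem_range.1 hw'
    have h1 : ((w : ℤ) - w' : ℤ) =
        M * (round (((w : ℝ) - μ) / M) - round (((w' : ℝ) - μ) / M)) := by
      have h2 : (w : ℝ) - w' = M * (round (((w : ℝ) - μ) / M) - round (((w' : ℝ) - μ) / M)) := by
        simp only [hr] at h; linarith
      exact_mod_cast h2
    have h3 := Int.eq_zero_of_abs_lt_dvd (m := (M : ℤ)) (x := (w : ℤ) - w') ⟨_, h1⟩ (by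
      rw [abs_lt]; constructor <;> omega)
    omega
  simp only [hcd]
  set S := (Finset.range M).filter fun w => e < |r w| with hS
  have hSmem : ∀ w ∈ S, w ∈ Finset.range M ∧ e < |r w| := fun w hw => by simpa [hS] using hw
  have hpos := sum_inv_sq_le (S.filter fun w => 0 ≤ r w) r he (fun w hw => by
    obtain ⟨h1, h2⟩ := Finset.mem_filter.1 hw
    have := (hSmem w h1).2
    rwa [abs_of_nonneg h2] at this) (hinj.mono fun w hw =>
      (hSmem w (Finset.mem_filter.1 hw).1).1) fun w _ w' _ => hint w w'
  have hneg := sum_inv_sq_le (S.filter fun w => ¬ 0 ≤ r w) (fun w => -r w) he (fun w hw => by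
    obtain ⟨h1, h2⟩ := Finset.mem_filter.1 hw
    have := (hSmem w h1).2
    rwa [abs_of_neg (not_le.1 h2)] at this) (fun w hw w' hw' h =>
      hinj (hSmem w (Finset.mem_filter.1 hw).1).1 (hSmem w' (Finset.mem_filter.1 hw').1).1
        (neg_injective h)) fun w _ w' _ => by
      obtain ⟨m, hm⟩ := hint w' w
      exact ⟨m, by linarith⟩
  simp only [neg_sq] at hneg
  -- Outcomes above and below the target each contribute at most `1 / (e - 1)`. The factor `1 / 4`
  -- is the square of the `1 / 2` in the amplitude bound.
  calc _ ≤ ∑ w ∈ S, 1 / 4 * (1 / (r w) ^ 2) :=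
        Finset.sum_le_sum fun w hw => hbd w (hSmem w hw).2
    _ = 1 / 4 * (∑ w ∈ S with 0 ≤ r w, 1 / (r w) ^ 2 + ∑ w ∈ S with ¬ 0 ≤ r w, 1 / (r w) ^ 2) := by
        rw [Finset.sum_filter_add_sum_filter_not, Finset.mul_sum]
    _ ≤ 1 / 4 * (1 / (e - 1) + 1 / (e - 1)) := by gcongr
    _ = _ := by
        have : e - 1 ≠ 0 := by linarith
        field_simp
        norm_num

/-! ### Multiplication as addition in the Fourier basis -/

/-- A phase between two Fourier transforms. -/
noncomputable def fourierAdd {t : ℕ} (a : Fin t → ι) (V : (ι → Bool) → ℝ) : Op ι :=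
  (qft a).conjTranspose *
    (phaseOp (fun b => 2 * Real.pi / 2 ^ t * V b * revVal a b) * qft a)

theorem AgreeOff.indep {t : ℕ} {a : Fin t → ι} {V : (ι → Bool) → ℝ} (hV : Indep V a)
    {b b' : ι → Bool} (h : AgreeOff a b' b) : V b' = V b := hV _ _ h

/-- Reduces sums over basis states to sums over the value of one register, the other qubits being
fixed by `b`. -/
theorem sum_agreeOff {t : ℕ} {a : Fin t → ι} (ha : a.Injective) (b : ι → Bool) {α : Type*}
    [AddCommMonoid α] (F : (ι → Bool) → α) (hF : ∀ c, ¬ AgreeOff a c b → F c = 0) (G : ℕ → α)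
    (hG : ∀ c, AgreeOff a c b → F c = G (val fun i => c (a i))) :
    ∑ c, F c = ∑ j ∈ Finset.range (2 ^ t), G j := by
  rw [← sum_val G]
  symm
  have hon : ∀ (s : Fin t → Bool) i, Function.extend a s b (a i) = s i := fun s i =>
    ha.extend_apply _ _ _
  have hoff : ∀ s : Fin t → Bool, AgreeOff a (Function.extend a s b) b := fun s q hq =>
    Function.extend_apply' _ _ _ fun ⟨i, e⟩ => hq i e.symm
  refine Fintype.sum_of_injective (fun s : Fin t → Bool => Function.extend a s b)
    (fun s s' h => funext fun i => ?_) _ _ (fun c hc => hF c fun h => hc ?_) fun s => ?_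
  · rw [← hon s i, ← hon s' i]
    exact congrFun h (a i)
  · refine ⟨fun i => c (a i), funext fun q => ?_⟩
    by_cases hq : ∀ i, q ≠ a i
    · exact (hoff _ q hq).trans (h q hq).symm
    · push Not at hq
      obtain ⟨i, rfl⟩ := hq
      exact hon _ i
  · rw [hG _ (hoff s)]
    congr 2
    exact funext fun i => (hon s i).symm

theorem AgreeOff.rev {t : ℕ} {a : Fin t → ι} {b b' : ι → Bool} :
    AgreeOff (fun i => a i.rev) b' b ↔ AgreeOff a b' b :=
  forall_congr' fun q => imp_congr_left
    ⟨fun h i => by simpa using h i.rev, fun h i => h _⟩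

open Classical in
-- Since `V` does not read the register, it is constant along the sum over Fourier indices. The
-- amplitude is then the mean of the characters at the discrepancy between the intended shift and
-- the observed one.
theorem fourierAdd_apply {t : ℕ} {a : Fin t → ι} (ha : a.Injective) {V : (ι → Bool) → ℝ}
    (hV : Indep V a) (b' b : ι → Bool) :
    fourierAdd a V b' b = if AgreeOff a b' b then
      fourierMean (2 ^ t) (V b + rval a b - rval a b') else 0 := by
  have h2 : ((Real.sqrt 2 : ℝ) : ℂ) ^ t * ((Real.sqrt 2 : ℝ) : ℂ) ^ t = 2 ^ t := by
    rw [← mul_pow, ← Complex.ofReal_mul, Real.mul_self_sqrt (by norm_num)]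
    norm_num
  rw [fourierAdd, Matrix.mul_apply]
  simp only [phaseOp, Matrix.diagonal_mul, Matrix.conjTranspose_apply, qft, Matrix.of_apply]
  split_ifs with h
  · rw [fourierMean, Finset.sum_div, Nat.cast_pow, Nat.cast_ofNat]
    -- The Fourier index is the value of the register read in reverse, as `qft` omits the final bit
    -- reversal.
    refine sum_agreeOff (a := fun i => a i.rev) (ha.comp Fin.rev_injective) b _
      (fun c hc => ?_) _ fun c hc => ?_
    · rw [if_neg fun h' => hc (AgreeOff.rev.2 h')]
      simp
    · have hcb := AgreeOff.rev.1 hc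
      have hcb' : AgreeOff a c b' := fun q hq => (hcb q hq).trans (h q hq).symm
      rw [if_pos hcb, if_pos hcb', AgreeOff.indep hV hcb, star_div₀, Complex.star_def,
        ← Complex.exp_conj, map_mul, Complex.conj_I, Complex.conj_ofReal, map_pow,
        Complex.conj_ofReal]
      have hrev : revVal a c = ((val fun i => c (a i.rev) : ℕ) : ℝ) := rfl
      rw [hrev, ← Complex.exp_nat_mul, div_mul_eq_mul_div, mul_div_assoc', mul_div_assoc', div_div,
        h2, ← Complex.exp_add, ← Complex.exp_add]
      congr 1
      · congr 1
        push_cast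
        field_simp
        ring
      · push_cast
        rfl
  · refine Finset.sum_eq_zero fun c _ => ?_
    by_cases h1 : AgreeOff a c b'
    · rw [if_neg (fun h3 : AgreeOff a c b => h fun q hq => (h1 q hq).symm.trans (h3 q hq)),
        mul_zero, mul_zero]
    · rw [if_neg h1, star_zero, zero_mul]

/-- The qubits of the third register. -/
def third (r s t : ℕ) : Fin t → Reg3 r s t := fun i => Sum.inr (Sum.inr i)

theorem third_injective (r s t : ℕ) : (third r s t).Injective :=
  Sum.inr_injective.comp Sum.inr_injective

theorem agreeOff_third {r s t : ℕ} (b' b : Reg3 r s t → Bool) :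
    AgreeOff (third r s t) b' b ↔ val1 b' = val1 b ∧ val2 b' = val2 b := by
  constructor
  · intro h
    constructor
    · exact val_congr (a := fun i => Sum.inl i) fun i => h _ fun j e => by simp [third] at e
    · exact val_congr (a := fun i => Sum.inr (Sum.inl i)) fun i =>
        h _ fun j e => by simp [third] at e
  · rintro ⟨h1, h2⟩ q hq
    rcases q with i | i | i
    · exact congrFun (val_injective _ h1) i
    · exact congrFun (val_injective _ h2) i
    · exact absurd rfl (hq i)

theorem indep_val1_val2 {r s t : ℕ} (x : ℝ) :
    Indep (fun b : Reg3 r s t → Bool => x * val1 b * val2 b) (third r s t) := fun b' b h => by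
  obtain ⟨h1, h2⟩ := (agreeOff_third b' b).1 h
  simp only [h1, h2]

theorem isScaledMultiply_fourierAdd {r s t : ℕ} (x : ℝ) :
    IsScaledMultiply x (fourierAdd (third r s t) fun b => x * val1 b * val2 b) := by
  classical
  have hap := fourierAdd_apply (third_injective r s t) (indep_val1_val2 (t := t) x)
  have hM : 0 < 2 ^ t := by positivity
  intro b
  refine ⟨fun b' h => ?_, fun v hv b' => ?_, fun e he => ?_⟩
  · rw [hap] at h
    by_contra h'
    exact h (if_neg fun h2 => h' ((agreeOff_third b' b).1 h2))
  · rw [hap]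
    have hδ : x * val1 b * val2 b + rval (third r s t) b - rval (third r s t) b' =
        ((v - (val3 b' : ℕ) : ℤ) : ℝ) := by
      push_cast
      rw [hv]
      simp only [rval, val3, third]
      ring
    rw [hδ]
    by_cases h : AgreeOff (third r s t) b' b
    · have h' := (agreeOff_third b' b).1 h
      rw [if_pos h, fourierMean_int hM]
      congr 1
      rw [eq_iff_iff]
      simp only [h', true_and]
      have hlt : (val3 b' : ℤ) < 2 ^ t := by
        have := val_lt fun i => b' (Sum.inr (Sum.inr i))
        exact_mod_cast this
      push_cast
      rw [← Int.modEq_iff_dvd, Int.ModEq, Int.emod_eq_of_lt (by positivity) hlt]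
    · rw [if_neg h, if_neg]
      rintro ⟨h1, h2, -⟩
      exact h ((agreeOff_third b' b).2 ⟨h1, h2⟩)
  · have key := sum_norm_fourierMean_le hM (val3 b + x * val1 b * val2 b) he
    refine le_trans (le_of_eq ?_) key
    rw [Finset.sum_filter, Finset.sum_filter]
    push_cast
    refine sum_agreeOff (third_injective r s t) b _ (fun c hc => ?_) _ fun c hc => ?_
    · rw [hap, if_neg hc]
      simp
    · rw [hap, if_pos hc]
      simp only [rval, val3, third]
      rw [add_comm (x * (val1 b : ℝ) * (val2 b : ℝ))]
      split_ifs <;> rfl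

theorem quantumMultiply_eq_of_isScaledMultiply {r s t : ℕ} {U : Op (Reg3 r s t)}
    (h : IsScaledMultiply 1 U) : U = quantumMultiply r s t := by
  ext b' b
  rw [(h b).2.1 ((val3 b + val1 b * val2 b : ℕ) : ℤ) (by push_cast; ring) b', quantumMultiply,
    Matrix.of_apply]
  congr 2
  rw [eq_iff_iff]
  norm_cast

/-- The middle phase is a triple product of `x`, `y` and the third register read in reverse. The
real multiplier only changes its angle, and reversing the order of the qubits costs no gates. -/
theorem impl_fourierAdd {r s t M P Q : ℕ} (hr : r ≤ M) (hs : s ≤ M) (ht : t ≤ M)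
    (hP : PTPBound M P) (hQ : QFTBound M Q) (x : ℝ) :
    Impl (fourierAdd (third r s t) fun b => x * val1 b * val2 b) (P + 2 * Q) := by
  have hq := hQ _ t (third r s t) ht (third_injective r s t)
  have hp : Ph (fun b => 2 * Real.pi / 2 ^ t * (x * val1 b * val2 b) * revVal (third r s t) b) P :=
    (hP (Reg3 r s t) r s t (fun i => Sum.inl i) (fun i => Sum.inr (Sum.inl i))
      (fun i => third r s t i.rev) hr hs ht Sum.inl_injective
      (Sum.inr_injective.comp Sum.inl_injective)
      ((third_injective r s t).comp Fin.rev_injective)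
      (fun i j e => by simp at e) (fun i j e => by simp [third] at e)
      (fun i j e => by simp [third] at e) (2 * Real.pi / 2 ^ t * x)).congr fun b => by
        simp only [revVal, rval, val1, val2]
        ring
  exact (hq.conjTranspose.mul (hp.mul hq)).mono (by omega)

/-! ### Circuits on a subset of the qubits -/

/-- A gate on a larger set of qubits. -/
def Gate.map {ι κ : Type} (e : ι → κ) (he : e.Injective) : Gate ι → Gate κ
  | .X i => .X (e i)
  | .H i => .H (e i)
  | .CNOT c i h => .CNOT (e c) (e i) (he.ne h)
  | .Toffoli c d i h1 h2 h3 => .Toffoli (e c) (e d) (e i) (he.ne h1) (he.ne h2) (he.ne h3)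
  | .R θ i => .R θ (e i)
  | .CR θ i j h => .CR θ (e i) (e j) (he.ne h)
  | .CCR θ i j l h1 h2 h3 => .CCR θ (e i) (e j) (e l) (he.ne h1) (he.ne h2) (he.ne h3)

open Classical in
/-- An operator on some of the qubits, as an operator on all of them. -/
noncomputable def liftOp {ι κ : Type} (e : ι → κ) (M : Op ι) : Op κ :=
  Matrix.of fun b' b => if (∀ q, (∀ i, q ≠ e i) → b' q = b q) then
    M (fun i => b' (e i)) (fun i => b (e i)) else 0

section lift
variable {κ : Type} [Fintype κ] [DecidableEq κ] {e : ι → κ}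

theorem liftOp_diagonal (θ : (ι → Bool) → ℂ) :
    liftOp e (Matrix.diagonal θ) = Matrix.diagonal fun b => θ fun i => b (e i) := by
  ext b' b
  simp only [liftOp, Matrix.of_apply, Matrix.diagonal_apply]
  by_cases h : b' = b
  · subst h; simp
  · rw [if_neg h]
    split_ifs with h1 h2
    · exfalso
      apply h
      funext q
      by_cases hq : ∀ i, q ≠ e i
      · exact h1 q hq
      · push Not at hq
        obtain ⟨i, rfl⟩ := hq
        exact congrFun h2 i
    · rfl
    · rfl

theorem liftOp_one : liftOp e (1 : Op ι) = 1 := by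
  rw [← Matrix.diagonal_one, liftOp_diagonal, Matrix.diagonal_one]

theorem liftOp_mul (he : e.Injective) (M N : Op ι) :
    liftOp e (M * N) = liftOp e M * liftOp e N := by
  ext b' b
  rw [Matrix.mul_apply]
  simp only [liftOp, Matrix.of_apply, Matrix.mul_apply]
  have hon : ∀ (s : ι → Bool) i, Function.extend e s b (e i) = s i := fun s i =>
    he.extend_apply _ _ _
  have hoff : ∀ (s : ι → Bool) q, (∀ i, q ≠ e i) → Function.extend e s b q = b q := fun s q hq =>
    Function.extend_apply' _ _ _ fun ⟨i, h⟩ => hq i h.symm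
  split_ifs with h
  · refine Fintype.sum_of_injective (fun s : ι → Bool => Function.extend e s b)
      (fun s s' hs => funext fun i => ?_) _ _ (fun c hc => ?_) fun s => ?_
    · rw [← hon s i, ← hon s' i]
      exact congrFun hs (e i)
    · by_cases h1 : ∀ q, (∀ i, q ≠ e i) → c q = b q
      · refine absurd ⟨fun i => c (e i), funext fun q => ?_⟩ hc
        by_cases hq : ∀ i, q ≠ e i
        · exact (hoff _ q hq).trans (h1 q hq).symm
        · push Not at hq
          obtain ⟨i, rfl⟩ := hq
          exact hon _ i
      · rw [if_neg h1, mul_zero]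
    · rw [if_pos fun q hq => (h q hq).trans (hoff s q hq).symm, if_pos fun q hq => hoff s q hq]
      simp only [hon]
  · symm
    refine Finset.sum_eq_zero fun c _ => ?_
    by_cases h1 : ∀ q, (∀ i, q ≠ e i) → c q = b q
    · rw [if_neg fun h2 => h fun q hq => (h2 q hq).trans (h1 q hq), zero_mul]
    · rw [if_neg h1, mul_zero]

theorem liftOp_basisMap (f : (ι → Bool) → (ι → Bool)) (F : (κ → Bool) → (κ → Bool))
    (h : ∀ b i, F b (e i) = f (fun j => b (e j)) i)
    (h' : ∀ b q, (∀ i, q ≠ e i) → F b q = b q) : liftOp e (basisMap f) = basisMap F := by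
  ext b' b
  simp only [liftOp, Matrix.of_apply, basisMap]
  by_cases hb : b' = F b
  · rw [if_pos hb, if_pos, if_pos]
    · rw [hb]; exact funext fun i => h b i
    · rw [hb]; exact h' b
  · rw [if_neg hb]
    split_ifs with h1 h2
    · exfalso
      apply hb
      funext q
      by_cases hq : ∀ i, q ≠ e i
      · rw [h1 q hq, h' b q hq]
      · push Not at hq
        obtain ⟨i, rfl⟩ := hq
        rw [h b i]
        exact congrFun h2 i
    · rfl
    · rfl

theorem liftOp_update (he : e.Injective) (i : ι) (v : (κ → Bool) → Bool)
    (v' : (ι → Bool) → Bool) (hv : ∀ b, v b = v' fun j => b (e j)) :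
    liftOp e (basisMap fun b => Function.update b i (v' b)) =
      basisMap fun b => Function.update b (e i) (v b) := by
  refine liftOp_basisMap _ _ (fun b j => ?_) fun b q hq => Function.update_of_ne (hq i) _ _
  by_cases hj : j = i
  · subst hj; simp [hv]
  · rw [Function.update_of_ne (he.ne hj), Function.update_of_ne hj]

theorem Gate.op_map (he : e.Injective) (g : Gate ι) : (g.map e he).op = liftOp e g.op := by
  cases g with
  | X i => exact (liftOp_update he i (fun b => !b (e i)) (fun b => !b i) fun _ => rfl).symm
  | CNOT c i h =>
    exact (liftOp_update he i (fun b => xor (b (e i)) (b (e c))) (fun b => xor (b i) (b c))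
      fun _ => rfl).symm
  | Toffoli c d i h1 h2 h3 =>
    exact (liftOp_update he i (fun b => xor (b (e i)) (b (e c) && b (e d)))
      (fun b => xor (b i) (b c && b d)) fun _ => rfl).symm
  | R θ i => simp only [Gate.map, Gate.op, phaseOp, liftOp_diagonal]
  | CR θ i j h => simp only [Gate.map, Gate.op, phaseOp, liftOp_diagonal]
  | CCR θ i j l h1 h2 h3 => simp only [Gate.map, Gate.op, phaseOp, liftOp_diagonal]
  | H i =>
    ext b' b
    simp only [Gate.map, Gate.op, liftOp, Matrix.of_apply]
    by_cases h : b' = Function.update b (e i) (b' (e i))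
    · have h1 : ∀ q, (∀ i, q ≠ e i) → b' q = b q := fun q hq => by
        rw [h, Function.update_of_ne (hq i)]
      have h2 : (fun i => b' (e i)) = Function.update (fun i => b (e i)) i (b' (e i)) := by
        funext j
        by_cases hj : j = i
        · subst hj; simp
        · rw [Function.update_of_ne hj, h, Function.update_of_ne (he.ne hj)]
      rw [if_pos h, if_pos h1, if_pos h2]
    · rw [if_neg h]
      split_ifs with h1 h2
      all_goals first | rfl | skip
      all_goals
        exfalso
        apply h
        funext q
        by_cases hq : ∀ i, q ≠ e i
        · rw [h1 q hq, Function.update_of_ne (hq i)]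
        · push Not at hq
          obtain ⟨j, rfl⟩ := hq
          by_cases hj : j = i
          · subst hj; simp
          · rw [Function.update_of_ne (he.ne hj)]
            simpa [Function.update_of_ne hj] using congrFun h2 j

theorem Circuit.op_map (he : e.Injective) (c : Circuit ι) :
    Circuit.op (c.map (Gate.map e he)) = liftOp e c.op := by
  induction c with
  | nil => exact liftOp_one.symm
  | cons g c ih => simp only [List.map_cons, Circuit.op, ih, Gate.op_map, liftOp_mul he]

theorem Ph.lift (he : e.Injective) {θ : (ι → Bool) → ℝ} {N : ℕ} (h : Ph θ N) :
    Ph (fun b : κ → Bool => θ fun i => b (e i)) N := by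
  obtain ⟨c, hc, hl⟩ := h
  refine ⟨c.map (Gate.map e he), ?_, by simpa using hl⟩
  rw [Circuit.op_map, hc, phaseOp, liftOp_diagonal]
  rfl

end lift

/-! ### One term of the decomposition -/

theorem Ph.neg {θ : (ι → Bool) → ℝ} {N : ℕ} (h : Ph θ N) : Ph (fun b => -θ b) N := by
  rw [Ph, ← phaseOp_conjTranspose]; exact Impl.conjTranspose h

theorem ph_pointwise {k l m p M P N K : ℕ} {φ : ℝ} (j₀ : Fin k) (a : Fin k → ℤ)
    (ha : a j₀ = 1 ∨ a j₀ = -1) (hK : ∑ i, (a i).natAbs ≤ K) (hl : l ≤ M) (hm : m ≤ M)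
    (hp : p ≤ M) (hP : PPBound M P)
    (hD : Ph (fun b : Reg3 l m p → Bool => φ * val1 b * val2 b * val3 b) N) :
    Ph (fun b : DigitReg3 k l m p → Bool =>
        φ * digitForm (fun i (j : Fin l) => (Sum.inl (i, j) : DigitReg3 k l m p)) a b
          * digitForm (fun i (j : Fin m) => (Sum.inr (Sum.inl (i, j)) : DigitReg3 k l m p)) a b
          * digitForm (fun i (j : Fin p) => (Sum.inr (Sum.inr (i, j)) : DigitReg3 k l m p)) a b)
      (N + K * ((k * k + k + 1) * (2 * P + 135 * M) + 66 * M)) := by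
  set X : Fin k → Fin l → DigitReg3 k l m p := fun i j => Sum.inl (i, j) with hX
  set Y : Fin k → Fin m → DigitReg3 k l m p := fun i j => Sum.inr (Sum.inl (i, j)) with hY
  set Z : Fin k → Fin p → DigitReg3 k l m p := fun i j => Sum.inr (Sum.inr (i, j)) with hZ
  have dX : Digits (len := fun _ => l) j₀ X M := ⟨fun i u v h => by simpa [hX] using h,
    fun i j hij u v h => hij (by simp [hX] at h; exact h.1), fun _ => le_rfl, hl⟩
  have dY : Digits (len := fun _ => m) j₀ Y M := ⟨fun i u v h => by simpa [hY] using h,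
    fun i j hij u v h => hij (by simp [hY] at h; exact h.1), fun _ => le_rfl, hm⟩
  have dZ : Digits (len := fun _ => p) j₀ Z M := ⟨fun i u v h => by simpa [hZ] using h,
    fun i j hij u v h => hij (by simp [hZ] at h; exact h.1), fun _ => le_rfl, hp⟩
  have hbase : Ph (fun b : DigitReg3 k l m p → Bool =>
      φ * rval (X j₀) b * rval (Y j₀) b * rval (Z j₀) b) N := by
    -- The given circuit is applied to the accumulator digits of the three registers.
    have he : Function.Injective (Sum.elim (X j₀) (Sum.elim (Y j₀) (Z j₀))) := by
      rintro (i | i | i) (j | j | j) h <;> simp [hX, hY, hZ] at h ⊢ <;> exact h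
    exact (hD.lift he).congr fun b => rfl
  have step : ∀ (ψ : ℝ) (a' : Fin k → ℤ), a' j₀ = 1 → ∑ i, (a' i).natAbs ≤ K →
      Ph (fun b => ψ * rval (X j₀) b * rval (Y j₀) b * rval (Z j₀) b) N →
      Ph (fun b => ψ * digitForm X a' b * digitForm Y a' b * digitForm Z a' b)
        (N + K * ((k * k + k + 1) * (2 * P + 135 * M) + 66 * M)) :=
    fun ψ a' h1 h2 h3 => ph_form_mul_form_mul_form dX dY dZ (fun i j u v h => by simp [hX, hY] at h)
      (fun i j u v h => by simp [hX, hZ] at h) (fun i j u v h => by simp [hY, hZ] at h) h1 h2 hP h3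
  rcases ha with ha | ha
  · exact step φ a ha hK hbase
  -- Negating three forms changes the sign of their product, which `-φ` undoes. The phase with `-φ`
  -- is the inverse of the given circuit, with the same number of gates.
  · refine (step (-φ) (fun i => -a i) (by simp [ha]) (by simpa using hK)
      (hbase.neg.congr fun b => by ring)).congr fun b => ?_
    simp only [digitForm, Int.cast_neg, neg_mul, Finset.sum_neg_distrib]
    ring

/-! ### Gate counts as powers of `n` -/

/-- Rounds `2n` up to a power of `k`. One of the two levels added to `Nat.log k n` rounds `n` up,
the other makes room for a register of `2n` qubits; together they cost the factor `q ^ 2`. -/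
theorem exists_pow_bound {k n q : ℕ} (hk : 2 ≤ k) (hn : n ≠ 0) (hq : 1 ≤ q) :
    ∃ d, 2 * n ≤ k ^ d ∧ ((q ^ d : ℕ) : ℝ) ≤ (q : ℝ) ^ 2 * (n : ℝ) ^ Real.logb k q := by
  refine ⟨Nat.log k n + 2, ?_, ?_⟩
  · have := Nat.lt_pow_succ_log_self (b := k) (by omega) n
    rw [pow_succ, mul_comm]
    exact Nat.mul_le_mul this.le hk
  · have hk1 : (1 : ℝ) < k := by exact_mod_cast hk
    have hq1 : (1 : ℝ) ≤ q := by exact_mod_cast hq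
    push_cast
    rw [pow_add, mul_comm]
    refine mul_le_mul_of_nonneg_left ?_ (by positivity)
    calc (q : ℝ) ^ Nat.log k n = ((k : ℝ) ^ Real.logb k q) ^ Nat.log k n := by
          rw [Real.rpow_logb (by linarith) hk1.ne' (by linarith)]
      _ = ((k : ℝ) ^ Nat.log k n) ^ Real.logb k q := Real.rpow_pow_comm (by linarith) _ _
      _ ≤ _ := by
          refine Real.rpow_le_rpow (by positivity) ?_ (Real.logb_nonneg hk1 hq1)
          exact_mod_cast Nat.pow_log_le_self k hn

theorem cast_two_mul_sub_one {k : ℕ} (hk : 2 ≤ k) : ((2 * k - 1 : ℕ) : ℝ) = 2 * k - 1 := by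
  rw [Nat.cast_sub (by omega)]; push_cast; ring

theorem cast_three_mul_sub_two {k : ℕ} (hk : 2 ≤ k) : ((3 * k - 2 : ℕ) : ℝ) = 3 * k - 2 := by
  rw [Nat.cast_sub (by omega)]; push_cast; ring

theorem le_mul_rpow_of_le {N A B d q n k : ℕ} {α : ℝ} (hα : Real.logb k q = α)
    (h : N ≤ B + A * q ^ d)
    (hd : ((q ^ d : ℕ) : ℝ) ≤ (q : ℝ) ^ 2 * (n : ℝ) ^ Real.logb k q) :
    (N : ℝ) ≤ B + (A * (q : ℝ) ^ 2) * (n : ℝ) ^ α := by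
  have h1 : (N : ℝ) ≤ B + A * ((q ^ d : ℕ) : ℝ) := by exact_mod_cast h
  rw [hα] at hd
  have := mul_le_mul_of_nonneg_left hd (Nat.cast_nonneg (α := ℝ) A)
  linarith

theorem evalPoint_eq_digitForm {ι : Type} {k l : ℕ} (X : Fin k → Fin l → ι) (u v : ℤ)
    (b : ι → Bool) :
    evalPoint (fun i => ((val fun j => b (X i j) : ℕ) : ℝ)) u v =
      digitForm (len := fun _ => l) X (fun i => u ^ (i : ℕ) * v ^ (k - 1 - (i : ℕ))) b := by
  rw [evalPoint, digitForm]
  refine Finset.sum_congr rfl fun i _ => ?_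
  rw [rval]
  push_cast
  ring

theorem exists_pointwise_circuit {k : ℕ} (hk : 2 ≤ k) (u v : ℤ) (huv : |u| = 1 ∨ |v| = 1) {κ : ℕ}
    (hκ : 2 ≤ κ) : ∃ C : ℝ, ∀ n l m p : ℕ, l ≤ n → m ≤ n → p ≤ 2 * n → ∀ φ : ℝ,
      ∀ D : Circuit (Reg3 l m p), D.op = phaseTripleProduct l m p φ →
        ∃ c : Circuit (DigitReg3 k l m p), c.op = pointwisePhase k l m p u v φ ∧
          (c.length : ℝ) ≤ D.length + C * (n : ℝ) ^ Real.logb κ (2 * κ - 1) := by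
  obtain ⟨A, hA⟩ := exists_ppBound hκ
  set a : Fin k → ℤ := fun i => u ^ (i : ℕ) * v ^ (k - 1 - (i : ℕ)) with ha
  set K := ∑ i, (a i).natAbs with hK
  have hunit : ∀ (z : ℤ) (j : ℕ), |z| = 1 → z ^ j = 1 ∨ z ^ j = -1 := fun z j hz =>
    (abs_eq zero_le_one).1 (by rw [abs_pow, hz, one_pow])
  -- The end coefficients of the form are `v ^ (k - 1)` and `u ^ (k - 1)`, so the hypothesis on the
  -- point makes one of them a sign and its digit a possible accumulator.
  obtain ⟨j₀, hj₀⟩ : ∃ j₀, a j₀ = 1 ∨ a j₀ = -1 := by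
    rcases huv with h | h
    · exact ⟨⟨k - 1, by omega⟩, by simpa [ha] using hunit u (k - 1) h⟩
    · exact ⟨⟨0, by omega⟩, by simpa [ha] using hunit v (k - 1) h⟩
  refine ⟨(K * ((k * k + k + 1) * (2 * A + 135) + 66) : ℕ) * ((2 * κ - 1 : ℕ) : ℝ) ^ 2,
    fun n l m p hl hm hp φ D hD => ?_⟩
  have hop : pointwisePhase k l m p u v φ = phaseOp fun b : DigitReg3 k l m p → Bool =>
        φ * digitForm (fun i (j : Fin l) => (Sum.inl (i, j) : DigitReg3 k l m p)) a b
          * digitForm (fun i (j : Fin m) => (Sum.inr (Sum.inl (i, j)) : DigitReg3 k l m p)) a b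
          * digitForm (fun i (j : Fin p) => (Sum.inr (Sum.inr (i, j)) : DigitReg3 k l m p)) a b := by
    rw [pointwisePhase]
    congr 1
    funext b
    rw [← evalPoint_eq_digitForm, ← evalPoint_eq_digitForm, ← evalPoint_eq_digitForm]
  -- For `n = 0` the first factor is empty and the phase is trivial; the empty circuit meets the
  -- bound.
  rcases Nat.eq_zero_or_pos n with rfl | hn
  · obtain rfl : l = 0 := by omega
    refine ⟨[], ?_, ?_⟩
    · rw [hop, Circuit.op, ← phaseOp_zero]
      congr 1
      funext b
      simp [digitForm, rval, val]
    · simp only [List.length_nil, Nat.cast_zero]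
      positivity
  · obtain ⟨d, hd1, hd2⟩ := exists_pow_bound (q := 2 * κ - 1) hκ hn.ne' (by omega)
    have hM : κ ^ d ≤ (2 * κ - 1) ^ d := Nat.pow_le_pow_left (by omega) d
    obtain ⟨c, hc, hlen⟩ := ph_pointwise j₀ a hj₀ le_rfl (show l ≤ κ ^ d by omega)
      (show m ≤ κ ^ d by omega) (show p ≤ κ ^ d by omega) (hA d) ⟨D, hD, le_rfl⟩
    refine ⟨c, hc.trans hop.symm, le_mul_rpow_of_le (by rw [cast_two_mul_sub_one hκ])
      (hlen.trans (Nat.add_le_add_left ?_ _)) hd2⟩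
    calc _ ≤ K * ((k * k + k + 1) * (2 * (A * (2 * κ - 1) ^ d) + 135 * (2 * κ - 1) ^ d) +
          66 * (2 * κ - 1) ^ d) := by gcongr
      _ = _ := by ring

theorem exists_controlledPhaseProduct_circuit {k : ℕ} (hk : 2 ≤ k) :
    ∃ C : ℝ, ∀ n r t : ℕ, r ≤ n → t ≤ 2 * n → ∀ φ : ℝ,
      ∃ c : Circuit (Unit ⊕ Fin r ⊕ Fin t), c.op = controlledPhaseProduct r t φ ∧
        (c.length : ℝ) ≤ C * (n : ℝ) ^ Real.logb k (2 * k - 1) := by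
  obtain ⟨A, hA⟩ := exists_ppBound hk
  -- In `Ctl.product`, `4r + 6t` contributes `10` and the control qubit `5`.
  refine ⟨(2 * A + 15 : ℕ) * ((2 * k - 1 : ℕ) : ℝ) ^ 2, fun n r t hr ht φ => ?_⟩
  set S : Fin r → Unit ⊕ Fin r ⊕ Fin t := fun i => Sum.inr (Sum.inl i) with hS
  set T : Fin t → Unit ⊕ Fin r ⊕ Fin t := fun i => Sum.inr (Sum.inr i) with hT
  have hop : controlledPhaseProduct r t φ = phaseOp fun b : Unit ⊕ Fin r ⊕ Fin t → Bool =>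
      φ * ((b (Sum.inl ())).toNat : ℝ) * rval S b * rval T b := by
    rw [controlledPhaseProduct]
    congr 1
    funext b
    cases b (Sum.inl ()) <;> simp [rval, hS, hT]
  rcases Nat.eq_zero_or_pos n with rfl | hn
  · obtain rfl : r = 0 := by omega
    refine ⟨[], ?_, ?_⟩
    · rw [hop, Circuit.op, ← phaseOp_zero]
      congr 1
      funext b
      simp [rval, val]
    · simp only [List.length_nil, Nat.cast_zero]
      positivity
  · obtain ⟨d, hd1, hd2⟩ := exists_pow_bound (q := 2 * k - 1) hk hn.ne' (by omega)
    have hM : k ^ d ≤ (2 * k - 1) ^ d := Nat.pow_le_pow_left (by omega) d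
    have hSi : S.Injective := Sum.inr_injective.comp Sum.inl_injective
    have hTi : T.Injective := Sum.inr_injective.comp Sum.inr_injective
    have hST : Disj S T := fun i j h => by simp [hS, hT] at h
    obtain ⟨c, hc, hlen⟩ := (Ctl.bit (Sum.inl () : Unit ⊕ Fin r ⊕ Fin t)).product hSi
      (fun i => by simp [hS]) hTi (fun i => by simp [hT]) hST
      (hA d _ r t S T (by omega) (by omega) hSi hTi hST) φ
    refine ⟨c, hc.trans hop.symm, ?_⟩
    have := le_mul_rpow_of_le (N := c.length) (A := 2 * A + 15) (B := 0)
      (by rw [cast_two_mul_sub_one hk]) ?_ hd2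
    · simpa using this
    · have h1 : 1 ≤ (2 * k - 1) ^ d := Nat.one_le_pow _ _ (by omega)
      rw [add_mul, mul_assoc]
      omega

theorem exists_phaseTripleProduct_circuit {k : ℕ} (hk : 2 ≤ k) :
    ∃ C : ℝ, ∀ n r s t : ℕ, r ≤ n → s ≤ n → t ≤ 2 * n → ∀ φ : ℝ,
      ∃ c : Circuit (Reg3 r s t), c.op = phaseTripleProduct r s t φ ∧
        (c.length : ℝ) ≤ C * (n : ℝ) ^ Real.logb k (3 * k - 2) := by
  obtain ⟨A, hA⟩ := exists_ptpBound hk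
  refine ⟨A * ((3 * k - 2 : ℕ) : ℝ) ^ 2, fun n r s t hr hs ht φ => ?_⟩
  rcases Nat.eq_zero_or_pos n with rfl | hn
  · obtain rfl : r = 0 := by omega
    refine ⟨[], ?_, ?_⟩
    · rw [phaseTripleProduct, Circuit.op, ← phaseOp_zero]
      congr 1
      funext b
      simp [val1, val]
    · simp only [List.length_nil, Nat.cast_zero]
      positivity
  · obtain ⟨d, hd1, hd2⟩ := exists_pow_bound (q := 3 * k - 2) hk hn.ne' (by omega)
    obtain ⟨c, hc, hlen⟩ := hA d (Reg3 r s t) r s t (fun i => Sum.inl i)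
      (fun i => Sum.inr (Sum.inl i)) (third r s t) (by omega) (by omega) (by omega)
      Sum.inl_injective (Sum.inr_injective.comp Sum.inl_injective) (third_injective r s t)
      (fun i j e => by simp at e) (fun i j e => by simp [third] at e)
      (fun i j e => by simp [third] at e) φ
    refine ⟨c, hc, ?_⟩
    have := le_mul_rpow_of_le (N := c.length) (A := A) (B := 0)
      (by rw [cast_three_mul_sub_two hk]) (by simpa using hlen) hd2
    simpa using this

theorem exists_fourierAdd_circuit {k : ℕ} (hk : 2 ≤ k) :
    ∃ C : ℝ, ∀ n r s t : ℕ, r ≤ n → s ≤ n → t ≤ 2 * n → ∀ x : ℝ,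
      ∃ c : Circuit (Reg3 r s t),
        c.op = fourierAdd (third r s t) (fun b => x * val1 b * val2 b) ∧
        (c.length : ℝ) ≤ C * (n : ℝ) ^ Real.logb k (3 * k - 2) := by
  obtain ⟨A, hA⟩ := exists_ptpBound hk
  obtain ⟨A', hA'⟩ := exists_qftBound hk
  refine ⟨(A + 2 * A' : ℕ) * ((3 * k - 2 : ℕ) : ℝ) ^ 2, fun n r s t hr hs ht x => ?_⟩
  rcases Nat.eq_zero_or_pos n with rfl | hn
  · obtain rfl : r = 0 := by omega
    obtain rfl : t = 0 := by omega
    refine ⟨[], ?_, ?_⟩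
    · rw [fourierAdd, qft_zero, Circuit.op, Matrix.conjTranspose_one, one_mul, mul_one,
        ← phaseOp_zero]
      congr 1
      funext b
      simp [val1, val]
    · simp only [List.length_nil, Nat.cast_zero]
      positivity
  · obtain ⟨d, hd1, hd2⟩ := exists_pow_bound (q := 3 * k - 2) hk hn.ne' (by omega)
    have hM : (2 * k - 1) ^ d ≤ (3 * k - 2) ^ d := Nat.pow_le_pow_left (by omega) d
    obtain ⟨c, hc, hlen⟩ := impl_fourierAdd (r := r) (s := s) (t := t) (M := k ^ d) (by omega)
      (by omega) (by omega) (hA d) (hA' d) x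
    refine ⟨c, hc, ?_⟩
    have := le_mul_rpow_of_le (N := c.length) (A := A + 2 * A') (B := 0)
      (by rw [cast_three_mul_sub_two hk]) (hlen.trans ?_) hd2
    · simpa using this
    · have := Nat.mul_le_mul_left (2 * A') hM
      rw [mul_assoc] at this
      rw [add_mul]
      omega

/-! ### The product polynomial and its interpolation -/

theorem natDegree_triple_le {k : ℕ} (x y z : Fin k → ℝ) :
    (digitPoly x * digitPoly y * digitPoly z).natDegree ≤ 3 * (k - 1) := by
  have h1 := digitPoly_natDegree_le x
  have h2 := digitPoly_natDegree_le y
  have h3 := digitPoly_natDegree_le z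
  have h4 := Polynomial.natDegree_mul_le (p := digitPoly x) (q := digitPoly y)
  have h5 := Polynomial.natDegree_mul_le (p := digitPoly x * digitPoly y) (q := digitPoly z)
  omega

theorem digitPoly_coeff {k : ℕ} (x : Fin k → ℝ) (i : Fin k) : (digitPoly x).coeff i = x i := by
  rw [digitPoly, Polynomial.finsetSum_coeff, Finset.sum_eq_single i]
  · simp
  · intro j _ hj
    rw [Polynomial.coeff_C_mul_X_pow, if_neg fun h => hj (Fin.ext h.symm)]
  · simp

theorem digitPoly_coeffs {k : ℕ} (P : Polynomial ℝ) (h : P.natDegree < k) :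
    digitPoly (fun i : Fin k => P.coeff i) = P := by
  conv_rhs => rw [P.as_sum_range' k h, Finset.sum_range]
  exact Finset.sum_congr rfl fun i _ => Polynomial.C_mul_X_pow_eq_monomial

theorem natDegree_triple_eq {k : ℕ} (hk : 2 ≤ k) (x y z : Fin k → ℝ)
    (h : ∀ i : Fin k, (i : ℕ) = k - 1 → x i ≠ 0 ∧ y i ≠ 0 ∧ z i ≠ 0) :
    (digitPoly x * digitPoly y * digitPoly z).natDegree = 3 * (k - 1) := by
  obtain ⟨hx, hy, hz⟩ := h ⟨k - 1, by omega⟩ rfl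
  have key : ∀ w : Fin k → ℝ, w ⟨k - 1, by omega⟩ ≠ 0 →
      (digitPoly w).natDegree = k - 1 ∧ digitPoly w ≠ 0 := fun w hw => by
    have hc : (digitPoly w).coeff (k - 1) ≠ 0 := by
      rwa [digitPoly_coeff w ⟨k - 1, by omega⟩]
    exact ⟨le_antisymm (digitPoly_natDegree_le w) (Polynomial.le_natDegree_of_ne_zero hc),
      fun h0 => hc (by rw [h0, Polynomial.coeff_zero])⟩
  rw [Polynomial.natDegree_mul (mul_ne_zero (key x hx).2 (key y hy).2) (key z hz).2,
    Polynomial.natDegree_mul (key x hx).2 (key y hy).2, (key x hx).1, (key y hy).1, (key z hz).1]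
  omega

theorem triple_eq_of_eval_eq {k : ℕ} (hk : 2 ≤ k) (S : Finset ℝ) (hS : S.card = 3 * k - 2)
    (x y z x' y' z' : Fin k → ℝ)
    (h : ∀ w ∈ S, (digitPoly x * digitPoly y * digitPoly z).eval w =
      (digitPoly x' * digitPoly y' * digitPoly z').eval w) :
    digitPoly x * digitPoly y * digitPoly z = digitPoly x' * digitPoly y' * digitPoly z' := by
  have hdeg : ∀ x y z : Fin k → ℝ,
      (digitPoly x * digitPoly y * digitPoly z).degree < S.card := fun x y z => by
    refine Polynomial.degree_le_natDegree.trans_lt (Nat.cast_lt.2 ?_)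
    have := natDegree_triple_le x y z
    omega
  exact Polynomial.eq_of_degrees_lt_of_eval_finset_eq S (hdeg x y z) (hdeg x' y' z') h

theorem exists_digits_vanishing {k : ℕ} (T : Finset ℝ) (hT : T.card < k) :
    ∃ x : Fin k → ℝ, digitPoly x ≠ 0 ∧ ∀ w ∈ T, (digitPoly x).eval w = 0 := by
  have hdeg : (∏ s ∈ T, (Polynomial.X - Polynomial.C s)).natDegree = T.card :=
    Polynomial.natDegree_finsetProd_X_sub_C_eq_card T fun s => s
  refine ⟨fun i => (∏ s ∈ T, (Polynomial.X - Polynomial.C s)).coeff i, ?_, fun w hw => ?_⟩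
  · rw [digitPoly_coeffs _ (hdeg.trans_lt hT)]
    exact Finset.prod_ne_zero_iff.2 fun s _ => Polynomial.X_sub_C_ne_zero s
  · rw [digitPoly_coeffs _ (hdeg.trans_lt hT), Polynomial.eval_prod]
    exact Finset.prod_eq_zero hw (by simp)

/-- At most `3(k - 1)` points split into three sets of at most `k - 1`. Each factor vanishes on one
of these sets, so the nonzero product has the same values there as the zero product. -/
theorem exists_triple_ne {k : ℕ} (hk : 2 ≤ k) (S : Finset ℝ) (hS : S.card < 3 * k - 2) :
    ∃ x y z x' y' z' : Fin k → ℝ,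
      (∀ w ∈ S, (digitPoly x * digitPoly y * digitPoly z).eval w =
        (digitPoly x' * digitPoly y' * digitPoly z').eval w) ∧
      digitPoly x * digitPoly y * digitPoly z ≠ digitPoly x' * digitPoly y' * digitPoly z' := by
  classical
  obtain ⟨T₁, h1, c1⟩ := Finset.exists_subset_card_eq (s := S) (n := min (k - 1) S.card) (by omega)
  have d1 := Finset.card_sdiff_of_subset h1
  obtain ⟨T₂, h2, c2⟩ := Finset.exists_subset_card_eq (s := S \ T₁)
    (n := min (k - 1) (S \ T₁).card) (by omega)
  have d2 := Finset.card_sdiff_of_subset h2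
  obtain ⟨x, hx, hx'⟩ := exists_digits_vanishing (k := k) T₁ (by omega)
  obtain ⟨y, hy, hy'⟩ := exists_digits_vanishing (k := k) T₂ (by omega)
  obtain ⟨z, hz, hz'⟩ := exists_digits_vanishing (k := k) ((S \ T₁) \ T₂) (by omega)
  have h0 : digitPoly (fun _ : Fin k => (0 : ℝ)) = 0 := by simp [digitPoly]
  refine ⟨x, y, z, fun _ => 0, fun _ => 0, fun _ => 0, fun w hw => ?_, ?_⟩
  · rw [h0, mul_zero, Polynomial.eval_zero, Polynomial.eval_mul, Polynomial.eval_mul]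
    by_cases m1 : w ∈ T₁
    · rw [hx' w m1, zero_mul, zero_mul]
    by_cases m2 : w ∈ T₂
    · rw [hy' w m2, mul_zero, zero_mul]
    rw [hz' w (by simp [hw, m1, m2]), mul_zero]
  · rw [h0, mul_zero]
    exact mul_ne_zero (mul_ne_zero hx hy) hz

/-- The determinant is the product of the cross differences, which are nonzero for distinct
projective points, infinity included. -/
theorem isUnit_projVandermonde {q : ℕ} (u v : Fin q → ℝ)
    (h : ∀ i j, i ≠ j → u i * v j ≠ u j * v i) : IsUnit (Matrix.projVandermonde u v) := by
  rw [Matrix.isUnit_iff_isUnit_det, isUnit_iff_ne_zero, Matrix.det_projVandermonde]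
  refine Finset.prod_ne_zero_iff.2 fun i _ => Finset.prod_ne_zero_iff.2 fun j hj => ?_
  exact sub_ne_zero.2 (h j i (Finset.mem_Ioi.1 hj).ne')

theorem sum_mul_sum_mul_sum {k : ℕ} (f g h : Fin k → ℝ) :
    (∑ i, f i) * (∑ i, g i) * (∑ i, h i) =
      ∑ w : Fin k × Fin k × Fin k, f w.1 * g w.2.1 * h w.2.2 := by
  simp only [Fintype.sum_prod_type, mul_assoc, ← Finset.mul_sum, ← Finset.sum_mul]

/-- By trilinearity it suffices to treat one digit of each factor. The three homogeneous monomials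
multiply to one of degree `3k - 3`, an entry of the projective Vandermonde matrix, and the weights
are chosen so that its column sums to `B ^ (i + j + w)`. -/
theorem phase_decomposition {k : ℕ} (u v : Fin (3 * k - 2) → ℝ)
    (h : ∀ i j, i ≠ j → u i * v j ≠ u j * v i) (φ B : ℝ) (x y z : Fin k → ℝ) :
    φ * (∑ i, x i * B ^ (i : ℕ)) * (∑ i, y i * B ^ (i : ℕ)) * (∑ i, z i * B ^ (i : ℕ)) =
      ∑ l, (φ • Matrix.vecMul (fun j : Fin (3 * k - 2) => B ^ (j : ℕ))
          (Matrix.projVandermonde u v)⁻¹) l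
        * (evalPoint x (u l) (v l) * evalPoint y (u l) (v l) * evalPoint z (u l) (v l)) := by
  set c := Matrix.vecMul (fun j : Fin (3 * k - 2) => B ^ (j : ℕ)) (Matrix.projVandermonde u v)⁻¹
    with hc
  have hdet := (Matrix.isUnit_iff_isUnit_det _).1 (isUnit_projVandermonde u v h)
  have hcA : Matrix.vecMul c (Matrix.projVandermonde u v) =
      fun j : Fin (3 * k - 2) => B ^ (j : ℕ) := by
    rw [hc, Matrix.vecMul_vecMul, Matrix.nonsing_inv_mul _ hdet, Matrix.vecMul_one]
  have key : ∀ i j w : Fin k, ∑ l, c l * ((u l ^ (i : ℕ) * v l ^ (k - 1 - (i : ℕ))) *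
      (u l ^ (j : ℕ) * v l ^ (k - 1 - (j : ℕ))) * (u l ^ (w : ℕ) * v l ^ (k - 1 - (w : ℕ)))) =
      B ^ (i : ℕ) * B ^ (j : ℕ) * B ^ (w : ℕ) := fun i j w => by
    have hi := i.2
    have hj := j.2
    have hw := w.2
    have hlt : (i : ℕ) + j + w < 3 * k - 2 := by omega
    have := congrFun hcA ⟨i + j + w, hlt⟩
    simp only [Matrix.vecMul, dotProduct, Matrix.projVandermonde_apply, Fin.val_rev] at this
    rw [← pow_add, ← pow_add, ← this]
    refine Finset.sum_congr rfl fun l _ => ?_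
    -- The exponents of `v` add up: `3(k - 1)` is one less than the number of points, so the three
    -- complementary exponents give the reversed index.
    rw [show 3 * k - 2 - ((i : ℕ) + j + w + 1) = (k - 1 - i) + (k - 1 - j) + (k - 1 - w) by omega,
      pow_add, pow_add, pow_add, pow_add]
    ring
  rw [mul_assoc, mul_assoc, ← mul_assoc (∑ i, x i * B ^ (i : ℕ)), sum_mul_sum_mul_sum]
  simp only [evalPoint, sum_mul_sum_mul_sum, Pi.smul_apply, smul_eq_mul]
  simp only [Finset.mul_sum]
  rw [Finset.sum_comm]
  refine Finset.sum_congr rfl fun w _ => ?_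
  have := congrArg (φ * (x w.1 * y w.2.1 * z w.2.2) * ·) (key w.1 w.2.1 w.2.2)
  simp only [Finset.mul_sum] at this
  calc _ = φ * (x w.1 * y w.2.1 * z w.2.2) *
        (B ^ (w.1 : ℕ) * B ^ (w.2.1 : ℕ) * B ^ (w.2.2 : ℕ)) := by ring
    _ = _ := this.symm
    _ = _ := Finset.sum_congr rfl fun l _ => by ring

theorem logb_three_mul_sub_two_lt {k : ℕ} (hk : 3 ≤ k) : Real.logb k (3 * k - 2) < 2 := by
  have hk' : (3 : ℝ) ≤ k := by exact_mod_cast hk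
  rw [Real.logb_lt_iff_lt_rpow (by linarith) (by linarith), Real.rpow_two]
  nlinarith

end QMul

theorem mainTheorem2 (k : ℕ) (hk : 2 ≤ k) :
    -- the product polynomial has degree `3 (k - 1)`
    (∀ x y z : Fin k → ℝ,
      (digitPoly x * digitPoly y * digitPoly z).natDegree ≤ 3 * (k - 1) ∧
      ((∀ i : Fin k, (i : ℕ) = k - 1 → x i ≠ 0 ∧ y i ≠ 0 ∧ z i ≠ 0) →
        (digitPoly x * digitPoly y * digitPoly z).natDegree = 3 * (k - 1))) ∧
    -- `3 k - 2` values determine it, fewer never do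
    (∀ S : Finset ℝ, S.card = 3 * k - 2 → ∀ x y z x' y' z' : Fin k → ℝ,
      (∀ w ∈ S, (digitPoly x * digitPoly y * digitPoly z).eval w =
        (digitPoly x' * digitPoly y' * digitPoly z').eval w) →
      digitPoly x * digitPoly y * digitPoly z = digitPoly x' * digitPoly y' * digitPoly z') ∧
    (∀ S : Finset ℝ, S.card < 3 * k - 2 → ∃ x y z x' y' z' : Fin k → ℝ,
      (∀ w ∈ S, (digitPoly x * digitPoly y * digitPoly z).eval w =
        (digitPoly x' * digitPoly y' * digitPoly z').eval w) ∧
      digitPoly x * digitPoly y * digitPoly z ≠ digitPoly x' * digitPoly y' * digitPoly z') ∧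
    -- the three-factor Toom-Cook decomposition of the phase, for any `3 k - 2` distinct points
    (∀ u v : Fin (3 * k - 2) → ℝ, (∀ i j, i ≠ j → u i * v j ≠ u j * v i) →
      IsUnit (Matrix.projVandermonde u v) ∧
      ∀ (φ B : ℝ) (x y z : Fin k → ℝ),
        φ * (∑ i, x i * B ^ (i : ℕ)) * (∑ i, y i * B ^ (i : ℕ)) * (∑ i, z i * B ^ (i : ℕ)) =
          ∑ l, (φ • Matrix.vecMul (fun j : Fin (3 * k - 2) => B ^ (j : ℕ))
              (Matrix.projVandermonde u v)⁻¹) l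
            * (evalPoint x (u l) (v l) * evalPoint y (u l) (v l) * evalPoint z (u l) (v l))) ∧
    -- each term of the decomposition: one smaller PhaseTripleProduct and, for the overflow bits,
    -- no more gates than controlled fast PhaseProducts need; no ancilla
    (∀ u v : ℤ, (|u| = 1 ∨ |v| = 1) → ∀ κ : ℕ, 2 ≤ κ → ∃ C : ℝ,
      ∀ n l m p : ℕ, l ≤ n → m ≤ n → p ≤ 2 * n → ∀ φ : ℝ, ∀ D : Circuit (Reg3 l m p),
        D.op = phaseTripleProduct l m p φ →
        ∃ c : Circuit (DigitReg3 k l m p),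
          c.op = pointwisePhase k l m p u v φ ∧
          (c.length : ℝ) ≤ D.length + C * (n : ℝ) ^ Real.logb κ (2 * κ - 1)) ∧
    -- controlled PhaseProduct, no ancilla
    (∃ C : ℝ, ∀ n r t : ℕ, r ≤ n → t ≤ 2 * n → ∀ φ : ℝ,
      ∃ c : Circuit (Unit ⊕ Fin r ⊕ Fin t),
        c.op = controlledPhaseProduct r t φ ∧
        (c.length : ℝ) ≤ C * (n : ℝ) ^ Real.logb k (2 * k - 1)) ∧
    -- PhaseTripleProduct, no ancilla
    (∃ C : ℝ, ∀ n r s t : ℕ, r ≤ n → s ≤ n → t ≤ 2 * n → ∀ φ : ℝ,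
      ∃ c : Circuit (Reg3 r s t),
        c.op = phaseTripleProduct r s t φ ∧
        (c.length : ℝ) ≤ C * (n : ℝ) ^ Real.logb k (3 * k - 2)) ∧
    -- quantum-quantum multiplication, no ancilla
    (∃ C : ℝ, ∀ n r s t : ℕ, r ≤ n → s ≤ n → t ≤ 2 * n →
      ∃ c : Circuit (Reg3 r s t),
        c.op = quantumMultiply r s t ∧
        (c.length : ℝ) ≤ C * (n : ℝ) ^ Real.logb k (3 * k - 2)) ∧
    -- classical-quantum-quantum multiplication by any real number, no ancilla
    (∃ C : ℝ, ∀ n r s t : ℕ, r ≤ n → s ≤ n → t ≤ 2 * n → ∀ a : ℝ,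
      ∃ c : Circuit (Reg3 r s t),
        IsScaledMultiply a c.op ∧
        (c.length : ℝ) ≤ C * (n : ℝ) ^ Real.logb k (3 * k - 2)) ∧
    -- the gate count is subquadratic
    (3 ≤ k → Real.logb k (3 * k - 2) < 2) := by
  have hq := exists_fourierAdd_circuit hk
  refine ⟨fun x y z => ⟨natDegree_triple_le x y z, natDegree_triple_eq hk x y z⟩,
    triple_eq_of_eval_eq hk, exists_triple_ne hk,
    fun u v h => ⟨isUnit_projVandermonde u v h, phase_decomposition u v h⟩,
    fun u v huv κ hκ => exists_pointwise_circuit hk u v huv hκ,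
    exists_controlledPhaseProduct_circuit hk, exists_phaseTripleProduct_circuit hk, ?_, ?_,
    logb_three_mul_sub_two_lt⟩
  -- With multiplier `1` the target is always an integer, so the exactness clause determines the
  -- whole operator.
  · obtain ⟨C, hC⟩ := hq
    refine ⟨C, fun n r s t hr hs ht => ?_⟩
    obtain ⟨c, hc, hlen⟩ := hC n r s t hr hs ht 1
    exact ⟨c, hc.trans (quantumMultiply_eq_of_isScaledMultiply (isScaledMultiply_fourierAdd 1)),
      hlen⟩
  · obtain ⟨C, hC⟩ := hq
    refine ⟨C, fun n r s t hr hs ht a => ?_⟩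
    obtain ⟨c, hc, hlen⟩ := hC n r s t hr hs ht a
    exact ⟨c, hc ▸ isScaledMultiply_fourierAdd a, hlen⟩
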